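/- Let $\mathfrak g$ be a finite-dimensional complex simple Lie algebra with Cartan subalgebra $\mathfrak h$, a choice of simple roots $\alpha_r$ ($r\in I$) with coroots $h_r\in\mathfrak h$, positive roots $\Delta^+$, triangular decomposition $\mathfrak g=\mathfrak n^-\oplus\mathfrak h\oplus\mathfrak n^+$, and Cartan matrix $a_{rs}=\alpha_s(h_r)$. Let $Q^+$ be the additive monoid generated by the simple roots. A *Lie $*$-algebra* is a complex Lie algebra with an antilinear involution $*$ such that $[x,y]^*=[y^*,x^*]$. Let $\mathfrak g_c\subseteq\mathfrak g$ be a compact real form and let $\dag$ be the antilinear involutive anti-automorphism of $\mathfrak g$ with $x^\dag=-x$ for $x\in\mathfrak g_c$. Assume that, for $\alpha\in\Delta^+$, nonzero root vectors $X_\alpha^{\pm}$ of weight $\pm\alpha$ are given with $(X_\alpha^+)^\dag=X_\alpha^-$ for all $\alpha\in\Delta^+$ and $[X_{\alpha_r}^+,X_{\alpha_r}^-]=h_r$ for all $r\in I$. Let $\varepsilon$ be a monoid homomorphism from $(Q^+,+)$ to $(\mathbb R,\cdot)$, and write $\varepsilon_r=\varepsilon_{\alpha_r}$. Let $S_\varepsilon^{\pm}:\mathfrak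 g\to\mathfrak g$ be the linear maps with $S_\varepsilon^{\pm}(X_\alpha^{\pm})=\varepsilon_\alpha X_\alpha^{\pm}$ for $\alpha\in\Delta^+$ and $S_\varepsilon^{\pm}(z)=z$ for $z\in\mathfrak h+\mathfrak n^{\mp}$, and let $$\mathfrak g_\varepsilon=\{(S_\varepsilon^+(z),S_\varepsilon^-(z)) : z\in\mathfrak g\}\subseteq\mathfrak g\oplus\mathfrak g,$$ a Lie $*$-subalgebra of $\mathfrak g\oplus\mathfrak g$ for the involution $(w,z)^*=(z^\dag,w^\dag)$. Let $\widetilde{\mathfrak g}_\varepsilon$ be the universal complex Lie algebra with generators $X_r^+,X_r^-,H_r$ ($r\in I$) and relations, for all $r,s\in I$, 1. $[H_r,H_s]=0$, 2. $[H_r,X_s^{\pm}]=\pm a_{rs}X_s^{\pm}$, 3. $\mathrm{ad}(X_r^{\pm})^{1-a_{rs}}(X_s^{\pm})=0$ if $r\neq s$, 4. $[X_r^+,X_s^-]=\delta_{rs}\,\varepsilon_r H_r$, with the $*$-operation determined by $(X_r^+)^*=X_r^-$ and $H_r^*=H_r$. Then the Lie $*$-algebras $\widetilde{\mathfrak g}_\varepsilon$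 and $\mathfrak g_\varepsilon$ are isomorphic, that is, there is a complex-linear Lie algebra isomorphism $\widetilde{\mathfrak g}_\varepsilon\to\mathfrak g_\varepsilon$ that commutes with the $*$-operations. -/

import Mathlib

namespace EpsLie

open LieAlgebra LieAlgebra.IsKilling LieModule

noncomputable section

/-! ### Lie `*`-algebras -/

/-- A `*`-operation on a complex Lie algebra: an antilinear, involutive anti-automorphism.
A Lie `*`-algebra is a complex Lie algebra together with such an operation. -/
@[ext]
structure LieInvolution (L : Type*) [LieRing L] [LieAlgebra ℂ L] where
  toFun : L → L
  map_add' : ∀ x y, toFun (x + y) = toFun x + toFun y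
  map_smul' : ∀ (c : ℂ) (x), toFun (c • x) = (starRingEnd ℂ) c • toFun x
  map_lie' : ∀ x y, toFun ⁅x, y⁆ = ⁅toFun y, toFun x⁆
  involutive' : ∀ x, toFun (toFun x) = x

namespace LieInvolution

variable {L : Type*} [LieRing L] [LieAlgebra ℂ L]

instance : CoeFun (LieInvolution L) (fun _ => L → L) := ⟨toFun⟩

variable (d : LieInvolution L)

lemma map_add (x y : L) : d (x + y) = d x + d y := d.map_add' x y
lemma map_smul (c : ℂ) (x : L) : d (c • x) = (starRingEnd ℂ) c • d x := d.map_smul' c x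
lemma map_lie (x y : L) : d ⁅x, y⁆ = ⁅d y, d x⁆ := d.map_lie' x y
lemma apply_apply (x : L) : d (d x) = x := d.involutive' x
lemma map_zero : d 0 = 0 := by simpa using d.map_smul 0 0

/-- The involution `(w, z) ↦ (d z, d w)` of `L ⊕ L`. -/
def swap : LieInvolution (L × L) where
  toFun x := (d x.2, d x.1)
  map_add' x y := by simp [d.map_add]
  map_smul' c x := by simp [d.map_smul]
  map_lie' x y := by simp [d.map_lie]
  involutive' x := by simp [d.apply_apply]

lemma swap_apply (w z : L) : d.swap (w, z) = (d z, d w) := rfl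

/-- The restriction of an involution to an invariant Lie subalgebra. -/
def restrict (K : LieSubalgebra ℂ L) (hK : ∀ x ∈ K, d x ∈ K) : LieInvolution K where
  toFun x := ⟨d x, hK x x.2⟩
  map_add' x y := Subtype.ext (d.map_add x y)
  map_smul' c x := Subtype.ext (d.map_smul c x)
  map_lie' x y := Subtype.ext (d.map_lie x y)
  involutive' x := Subtype.ext (d.apply_apply x)

end LieInvolution

/-! ### Compact real forms -/

section Compact

variable {L : Type*} [LieRing L] [LieAlgebra ℂ L]

/-- A complex Lie algebra, seen as a real one. -/
@[reducible] def realLieAlgebra (L : Type*) [LieRing L] [LieAlgebra ℂ L] : LieAlgebra ℝ L where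
  toModule := Module.complexToReal L
  lie_smul t x y := by
    rw [← Complex.coe_smul t y, lie_smul, Complex.coe_smul]

attribute [local instance] realLieAlgebra

/-- The real form `{x | d x = -x}` attached to an antilinear involutive anti-automorphism `d`. -/
def LieInvolution.realForm (d : LieInvolution L) : LieSubalgebra ℝ L where
  carrier := {x | d x = -x}
  zero_mem' := by simp [d.map_zero]
  add_mem' := by
    intro x y hx hy
    simp only [Set.mem_ofPred_eq] at *
    rw [d.map_add, hx, hy, neg_add]
  smul_mem' := by
    intro t x hx
    simp only [Set.mem_ofPred_eq] at *
    rw [← Complex.coe_smul t x, d.map_smul, hx, Complex.conj_ofReal, smul_neg]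
  lie_mem' := by
    intro x y hx hy
    change d ⁅x, y⁆ = -⁅x, y⁆
    change d x = -x at hx
    change d y = -y at hy
    rw [d.map_lie, hx, hy, neg_lie, lie_neg, neg_neg, lie_skew]

/-- The real form `{x | d x = -x}` is compact: its Killing form is negative definite. -/
def LieInvolution.IsCompact (d : LieInvolution L) : Prop :=
  ∀ x : d.realForm, x ≠ 0 → killingForm ℝ d.realForm x x < 0

end Compact

/-! ### The presented Lie `*`-algebra -/

section Presentation

variable {I : Type*}

/-- The generators `X_r⁺`, `X_r⁻`, `H_r`. -/
inductive Gen (I : Type*)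
  | Xp : I → Gen I
  | Xm : I → Gen I
  | H : I → Gen I

/-- The generators, inside the free complex Lie algebra. -/
abbrev xp (r : I) : FreeLieAlgebra ℂ (Gen I) := FreeLieAlgebra.of ℂ (Gen.Xp r)
abbrev xm (r : I) : FreeLieAlgebra ℂ (Gen I) := FreeLieAlgebra.of ℂ (Gen.Xm r)
abbrev hh (r : I) : FreeLieAlgebra ℂ (Gen I) := FreeLieAlgebra.of ℂ (Gen.H r)

/-- The defining relators (each is set to be zero), for an integer matrix `a` and real
numbers `ε r`: torus relations, Serre relations, and `ε`-coupling relations. -/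
inductive Relator (a : Matrix I I ℤ) (ε : I → ℝ) : FreeLieAlgebra ℂ (Gen I) → Prop
  | HH (r s : I) : Relator a ε ⁅hh r, hh s⁆
  | Tp (r s : I) : Relator a ε (⁅hh r, xp s⁆ - (a r s : ℂ) • xp s)
  | Tm (r s : I) : Relator a ε (⁅hh r, xm s⁆ + (a r s : ℂ) • xm s)
  | Sp (r s : I) (h : r ≠ s) :
      Relator a ε (((LieAlgebra.ad ℂ _ (xp r)) ^ (1 - a r s).toNat) (xp s))
  | Sm (r s : I) (h : r ≠ s) :
      Relator a ε (((LieAlgebra.ad ℂ _ (xm r)) ^ (1 - a r s).toNat) (xm s))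
  | Cs (r : I) : Relator a ε (⁅xp r, xm r⁆ - (ε r : ℂ) • hh r)
  | Cn (r s : I) (h : r ≠ s) : Relator a ε ⁅xp r, xm s⁆

/-- The ideal generated by the relators. -/
def relIdeal (a : Matrix I I ℤ) (ε : I → ℝ) : LieIdeal ℂ (FreeLieAlgebra ℂ (Gen I)) :=
  LieSubmodule.lieSpan ℂ _ {x | Relator a ε x}

/-- The universal complex Lie algebra with the above generators and relations. -/
abbrev GTilde (a : Matrix I I ℤ) (ε : I → ℝ) : Type _ :=
  FreeLieAlgebra ℂ (Gen I) ⧸ relIdeal a ε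

namespace GTilde

variable (a : Matrix I I ℤ) (ε : I → ℝ)

/-- The quotient map. -/
def proj : FreeLieAlgebra ℂ (Gen I) →ₗ⁅ℂ⁆ GTilde a ε where
  toLinearMap := (LieSubmodule.Quotient.mk' (relIdeal a ε)).toLinearMap
  map_lie' := by
    intro x y
    exact LieSubmodule.Quotient.mk_bracket (I := relIdeal a ε) x y

/-- The generators of the presented Lie algebra. -/
def Xp (r : I) : GTilde a ε := proj a ε (xp r)
def Xm (r : I) : GTilde a ε := proj a ε (xm r)
def H (r : I) : GTilde a ε := proj a ε (hh r)

lemma proj_surjective : Function.Surjective (proj a ε) :=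
  LieSubmodule.Quotient.surjective_mk' (relIdeal a ε)

lemma proj_eq_zero_iff (x) : proj a ε x = 0 ↔ x ∈ relIdeal a ε :=
  LieSubmodule.Quotient.mk_eq_zero (N := relIdeal a ε)

lemma proj_relator {x} (hx : Relator a ε x) : proj a ε x = 0 :=
  (proj_eq_zero_iff a ε x).2 (LieSubmodule.subset_lieSpan hx)

variable {a ε} in
lemma lift_aux {L : Type*} [LieRing L] [LieAlgebra ℂ L] (f : FreeLieAlgebra ℂ (Gen I) →ₗ⁅ℂ⁆ L)
    (hf : ∀ x, Relator a ε x → f x = 0) (x) (hx : x ∈ relIdeal a ε) : f x = 0 := by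
  have : relIdeal a ε ≤ f.ker := LieSubmodule.lieSpan_le.2 fun y hy => by
    simpa using hf y hy
  simpa using this hx

end GTilde

/-- The complex conjugate of the opposite of a complex Lie algebra (an auxiliary device:
linear Lie homomorphisms into it are the antilinear anti-homomorphisms into `L`). -/
def ConjOpp (L : Type*) := L

namespace ConjOpp

variable (L : Type*) [LieRing L] [LieAlgebra ℂ L]

instance : AddCommGroup (ConjOpp L) := inferInstanceAs (AddCommGroup L)

/-- The identity map, as an additive equivalence. -/
def of : L ≃+ ConjOpp L := AddEquiv.refl L

instance : LieRing (ConjOpp L) where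
  bracket x y := of L ⁅(of L).symm y, (of L).symm x⁆
  add_lie x y z := by simp
  lie_add x y z := by simp
  lie_self x := by simp
  leibniz_lie x y z := by
    simp only [AddEquiv.symm_apply_apply, ← _root_.map_add]
    congr 1
    generalize (of L).symm x = x
    generalize (of L).symm y = y
    generalize (of L).symm z = z
    rw [leibniz_lie z y x, ← lie_skew ⁅z, x⁆ y, add_assoc, add_neg_cancel, add_zero]

instance : Module ℂ (ConjOpp L) where
  smul c x := of L ((starRingEnd ℂ) c • (of L).symm x)
  one_smul x := by
    change of L ((starRingEnd ℂ) 1 • (of L).symm x) = x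
    simp
  mul_smul c c' x := by
    change of L ((starRingEnd ℂ) (c * c') • (of L).symm x) =
      of L ((starRingEnd ℂ) c • (of L).symm (of L ((starRingEnd ℂ) c' • (of L).symm x)))
    simp [mul_smul]
  smul_zero c := by
    change of L ((starRingEnd ℂ) c • (of L).symm 0) = 0
    simp
  smul_add c x y := by
    change of L ((starRingEnd ℂ) c • (of L).symm (x + y)) =
      of L ((starRingEnd ℂ) c • (of L).symm x) + of L ((starRingEnd ℂ) c • (of L).symm y)
    simp
  add_smul c c' x := by
    change of L ((starRingEnd ℂ) (c + c') • (of L).symm x) =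
      of L ((starRingEnd ℂ) c • (of L).symm x) + of L ((starRingEnd ℂ) c' • (of L).symm x)
    simp [add_smul]
  zero_smul x := by
    change of L ((starRingEnd ℂ) 0 • (of L).symm x) = 0
    simp

lemma of_smul (c : ℂ) (x : L) : of L (c • x) = (starRingEnd ℂ) c • of L x := by
  change of L (c • x) = of L ((starRingEnd ℂ) ((starRingEnd ℂ) c) • (of L).symm (of L x))
  simp

lemma symm_smul (c : ℂ) (x : ConjOpp L) :
    (of L).symm (c • x) = (starRingEnd ℂ) c • (of L).symm x := by
  change (of L).symm (of L ((starRingEnd ℂ) c • (of L).symm x)) = _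
  simp

lemma of_lie (x y : L) : of L ⁅x, y⁆ = ⁅of L y, of L x⁆ := rfl

lemma symm_lie (x y : ConjOpp L) :
    (of L).symm ⁅x, y⁆ = ⁅(of L).symm y, (of L).symm x⁆ := rfl

instance : LieAlgebra ℂ (ConjOpp L) where
  lie_smul c x y := by
    apply (of L).symm.injective
    rw [symm_lie, symm_smul, symm_smul, symm_lie, smul_lie]

lemma of_ad_pow (x y : L) (n : ℕ) :
    of L (((LieAlgebra.ad ℂ L x) ^ n) y) =
      (-1 : ℂ) ^ n • ((LieAlgebra.ad ℂ (ConjOpp L) (of L x)) ^ n) (of L y) := by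
  induction n with
  | zero => simp
  | succ n ih =>
    rw [pow_succ', pow_succ', pow_succ', Module.End.mul_apply, Module.End.mul_apply,
      LieAlgebra.ad_apply, LieAlgebra.ad_apply, of_lie, ih, ← lie_skew, lie_smul,
      mul_smul, neg_one_smul]

end ConjOpp

namespace GTilde

variable (a : Matrix I I ℤ) (ε : I → ℝ)

/-- The antilinear anti-homomorphism on the free Lie algebra which exchanges `X_r⁺` and `X_r⁻`
and fixes `H_r`, with values in the presented Lie algebra. -/
def starFree : FreeLieAlgebra ℂ (Gen I) →ₗ⁅ℂ⁆ ConjOpp (GTilde a ε) :=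
  FreeLieAlgebra.lift ℂ fun
    | .Xp r => ConjOpp.of _ (Xm a ε r)
    | .Xm r => ConjOpp.of _ (Xp a ε r)
    | .H r => ConjOpp.of _ (H a ε r)

lemma starFree_xp (r : I) : starFree a ε (xp r) = ConjOpp.of _ (Xm a ε r) := by
  simp [starFree, xp]

lemma starFree_xm (r : I) : starFree a ε (xm r) = ConjOpp.of _ (Xp a ε r) := by
  simp [starFree, xm]

lemma starFree_hh (r : I) : starFree a ε (hh r) = ConjOpp.of _ (H a ε r) := by
  simp [starFree, hh]

lemma map_ad_pow {L L' : Type*} [LieRing L] [LieAlgebra ℂ L] [LieRing L'] [LieAlgebra ℂ L']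
    (f : L →ₗ⁅ℂ⁆ L') (x y : L) (n : ℕ) :
    f (((LieAlgebra.ad ℂ L x) ^ n) y) = ((LieAlgebra.ad ℂ L' (f x)) ^ n) (f y) := by
  induction n with
  | zero => simp
  | succ n ih => simp [pow_succ', ih]

lemma starFree_relator (x) (hx : Relator a ε x) : starFree a ε x = 0 := by
  have key : ∀ {u v : GTilde a ε} (n : ℕ), ((LieAlgebra.ad ℂ _ u) ^ n) v = 0 →
      ((LieAlgebra.ad ℂ _ (ConjOpp.of _ u)) ^ n) (ConjOpp.of _ v) = 0 := by
    intro u v n h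
    have := ConjOpp.of_ad_pow _ u v n
    rw [h, _root_.map_zero] at this
    exact (smul_eq_zero.1 this.symm).resolve_left (by simp)
  cases hx with
  | HH r s =>
    rw [LieHom.map_lie, starFree_hh, starFree_hh, ← ConjOpp.of_lie]
    simpa [H] using proj_relator a ε (Relator.HH s r)
  | Tp r s =>
    have h := proj_relator a ε (Relator.Tm r s)
    simp only [_root_.map_add, LieHom.map_lie, _root_.map_smul] at h
    rw [map_sub, _root_.map_smul, LieHom.map_lie, starFree_hh, starFree_xp,
      ← ConjOpp.of_lie]
    have h2 : ((a r s : ℤ) : ℂ) • ConjOpp.of _ (Xm a ε s) =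
        ConjOpp.of _ (((a r s : ℤ) : ℂ) • Xm a ε s) := by
      rw [ConjOpp.of_smul]; simp
    rw [h2, ← map_sub, EmbeddingLike.map_eq_zero_iff, ← lie_skew]
    rw [← neg_eq_zero, neg_sub, sub_neg_eq_add, add_comm]
    exact h
  | Tm r s =>
    have h := proj_relator a ε (Relator.Tp r s)
    simp only [map_sub, LieHom.map_lie, _root_.map_smul] at h
    rw [_root_.map_add, _root_.map_smul, LieHom.map_lie, starFree_hh, starFree_xm,
      ← ConjOpp.of_lie]
    have h2 : ((a r s : ℤ) : ℂ) • ConjOpp.of _ (Xp a ε s) =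
        ConjOpp.of _ (((a r s : ℤ) : ℂ) • Xp a ε s) := by
      rw [ConjOpp.of_smul]; simp
    rw [h2, ← _root_.map_add, EmbeddingLike.map_eq_zero_iff, ← lie_skew]
    rw [← neg_eq_zero, neg_add, neg_neg, ← sub_eq_add_neg]
    exact h
  | Sp r s h =>
    rw [map_ad_pow, starFree_xp, starFree_xp]
    apply key
    have := proj_relator a ε (Relator.Sm r s h)
    rwa [map_ad_pow] at this
  | Sm r s h =>
    rw [map_ad_pow, starFree_xm, starFree_xm]
    apply key
    have := proj_relator a ε (Relator.Sp r s h)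
    rwa [map_ad_pow] at this
  | Cs r =>
    have h := proj_relator a ε (Relator.Cs r)
    simp only [map_sub, LieHom.map_lie, _root_.map_smul] at h
    rw [map_sub, _root_.map_smul, LieHom.map_lie, starFree_xp, starFree_xm, starFree_hh,
      ← ConjOpp.of_lie]
    have h2 : ((ε r : ℝ) : ℂ) • ConjOpp.of _ (H a ε r) =
        ConjOpp.of _ (((ε r : ℝ) : ℂ) • H a ε r) := by
      rw [ConjOpp.of_smul]; simp
    rw [h2, ← map_sub, EmbeddingLike.map_eq_zero_iff]
    exact h
  | Cn r s h =>
    rw [LieHom.map_lie, starFree_xp, starFree_xm, ← ConjOpp.of_lie]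
    have := proj_relator a ε (Relator.Cn s r (Ne.symm h))
    rw [LieHom.map_lie] at this
    rw [EmbeddingLike.map_eq_zero_iff]
    exact this

/-- The underlying linear map of the `*`-operation on the presented Lie algebra. -/
def starLin : GTilde a ε →ₗ[ℂ] ConjOpp (GTilde a ε) :=
  (relIdeal a ε).toSubmodule.liftQ (starFree a ε).toLinearMap fun x hx =>
    lift_aux (starFree a ε) (starFree_relator a ε) x hx

lemma starLin_proj (x) : starLin a ε (proj a ε x) = starFree a ε x := rfl

lemma starLin_lie (x y : GTilde a ε) :
    starLin a ε ⁅x, y⁆ = ⁅starLin a ε x, starLin a ε y⁆ := by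
  obtain ⟨x, rfl⟩ := proj_surjective a ε x
  obtain ⟨y, rfl⟩ := proj_surjective a ε y
  rw [← LieHom.map_lie, starLin_proj, starLin_proj, starLin_proj, LieHom.map_lie]

/-- Applying the `*`-operation twice, as a linear Lie homomorphism. -/
def starSq : FreeLieAlgebra ℂ (Gen I) →ₗ⁅ℂ⁆ GTilde a ε where
  toFun x := (ConjOpp.of _).symm (starLin a ε ((ConjOpp.of _).symm (starLin a ε (proj a ε x))))
  map_add' x y := by simp
  map_smul' c x := by
    simp only [_root_.map_smul, _root_.map_smul, ConjOpp.symm_smul, RingHom.id_apply,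
      Complex.conj_conj]
  map_lie' {x y} := by
    rw [LieHom.map_lie, starLin_lie, ConjOpp.symm_lie, starLin_lie, ConjOpp.symm_lie]

lemma starSq_eq : starSq a ε = proj a ε := by
  apply FreeLieAlgebra.hom_ext
  rintro (r | r | r)
  · change (ConjOpp.of _).symm (starLin a ε ((ConjOpp.of _).symm (starFree a ε (xp r)))) = _
    rw [starFree_xp, AddEquiv.symm_apply_apply, Xm, starLin_proj, starFree_xm,
      AddEquiv.symm_apply_apply, Xp]
  · change (ConjOpp.of _).symm (starLin a ε ((ConjOpp.of _).symm (starFree a ε (xm r)))) = _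
    rw [starFree_xm, AddEquiv.symm_apply_apply, Xp, starLin_proj, starFree_xp,
      AddEquiv.symm_apply_apply, Xm]
  · change (ConjOpp.of _).symm (starLin a ε ((ConjOpp.of _).symm (starFree a ε (hh r)))) = _
    rw [starFree_hh, AddEquiv.symm_apply_apply, H, starLin_proj, starFree_hh,
      AddEquiv.symm_apply_apply, H]

/-- The `*`-operation of the presented Lie algebra, with `(X_r⁺)* = X_r⁻` and `H_r* = H_r`. -/
def star : LieInvolution (GTilde a ε) where
  toFun x := (ConjOpp.of _).symm (starLin a ε x)
  map_add' x y := by simp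
  map_smul' c x := by rw [_root_.map_smul, ConjOpp.symm_smul]
  map_lie' x y := by rw [starLin_lie, ConjOpp.symm_lie]
  involutive' x := by
    obtain ⟨x, rfl⟩ := proj_surjective a ε x
    exact DFunLike.congr_fun (starSq_eq a ε) x

lemma star_Xp (r : I) : star a ε (Xp a ε r) = Xm a ε r := by
  change (ConjOpp.of _).symm (starLin a ε (proj a ε (xp r))) = _
  rw [starLin_proj, starFree_xp, AddEquiv.symm_apply_apply]

lemma star_Xm (r : I) : star a ε (Xm a ε r) = Xp a ε r := by
  change (ConjOpp.of _).symm (starLin a ε (proj a ε (xm r))) = _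
  rw [starLin_proj, starFree_xm, AddEquiv.symm_apply_apply]

lemma star_H (r : I) : star a ε (H a ε r) = H a ε r := by
  change (ConjOpp.of _).symm (starLin a ε (proj a ε (hh r))) = _
  rw [starLin_proj, starFree_hh, AddEquiv.symm_apply_apply]

end GTilde

end Presentation

/-! ### The contracted Lie `*`-algebra inside `𝔤 ⊕ 𝔤` -/

section Contraction

variable {𝔤 : Type*} [LieRing 𝔤] [LieAlgebra ℂ 𝔤] [FiniteDimensional ℂ 𝔤] [IsKilling ℂ 𝔤]
  {𝔥 : LieSubalgebra ℂ 𝔤} [𝔥.IsCartanSubalgebra]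

/-- The monoid `Q⁺` of natural-number combinations of the simple roots. -/
def QPlus (b : (rootSystem 𝔥).Base) : AddSubmonoid (Module.Dual ℂ 𝔥) :=
  AddSubmonoid.closure ((rootSystem 𝔥).root '' b.support)

/-- The real characters of `Q⁺`: monoid homomorphisms `(Q⁺, +) → (ℝ, ·)`. -/
abbrev RealChar (b : (rootSystem 𝔥).Base) := Multiplicative (QPlus b) →* ℝ

/-- The positive roots. -/
abbrev PosRoot (b : (rootSystem 𝔥).Base) :=
  {α : 𝔥.root // (rootSystem 𝔥).root α ∈ QPlus b}

lemma simple_mem (b : (rootSystem 𝔥).Base) (r : b.support) :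
    (rootSystem 𝔥).root r ∈ QPlus b :=
  AddSubmonoid.subset_closure ⟨r, r.2, rfl⟩

/-- The simple root `α_r`, as a positive root. -/
def simple (b : (rootSystem 𝔥).Base) (r : b.support) : PosRoot b := ⟨r, simple_mem b r⟩

/-- The value `ε_α` at a positive root. -/
def RealChar.at {b : (rootSystem 𝔥).Base} (ε : RealChar b) (α : PosRoot b) : ℝ :=
  ε (Multiplicative.ofAdd ⟨(rootSystem 𝔥).root α.1, α.2⟩)

/-- The Cartan matrix `a_{rs} = α_s (h_r)`, where `h_r` is the coroot of `α_r`. (Mathlib's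
`cartanMatrix` has the coroot in the second index.) -/
def cartan (b : (rootSystem 𝔥).Base) : Matrix b.support b.support ℤ :=
  fun r s => b.cartanMatrix s r

lemma cartan_spec (b : (rootSystem 𝔥).Base) (r s : b.support) :
    ((cartan b r s : ℤ) : ℂ) = (rootSystem 𝔥).root s ((rootSystem 𝔥).coroot r) := by
  have := b.algebraMap_cartanMatrixIn_apply ℤ s r
  simpa [cartan] using this

open scoped Classical in
/-- The root space decomposition. -/
lemma isInternal (𝔥 : LieSubalgebra ℂ 𝔤) [𝔥.IsCartanSubalgebra] :
    Function.Bijective (DirectSum.coeLinearMap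
      fun χ : Weight ℂ 𝔥 𝔤 => (rootSpace 𝔥 χ).toSubmodule) := by
  exact DirectSum.isInternal_submodule_of_iSupIndep_of_iSup_eq_top
    (LieSubmodule.iSupIndep_toSubmodule.mpr <| iSupIndep_genWeightSpace' ℂ 𝔥 𝔤)
    (LieSubmodule.iSup_toSubmodule_eq_top.mpr <| iSup_genWeightSpace_eq_top' ℂ 𝔥 𝔤)

open scoped Classical in
/-- The linear endomorphism of `𝔤` acting on each weight space of `𝔥` as the scalar `c χ`. -/
def weightScale (c : Weight ℂ 𝔥 𝔤 → ℝ) : 𝔤 →ₗ[ℂ] 𝔤 :=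
  (DirectSum.toModule ℂ (Weight ℂ 𝔥 𝔤) 𝔤 fun χ =>
    (c χ : ℂ) • (rootSpace 𝔥 χ).toSubmodule.subtype) ∘ₗ
  (LinearEquiv.ofBijective _ (isInternal 𝔥)).symm.toLinearMap

lemma weightScale_apply (c : Weight ℂ 𝔥 𝔤 → ℝ) (χ : Weight ℂ 𝔥 𝔤) {z : 𝔤}
    (hz : z ∈ rootSpace 𝔥 χ) : weightScale c z = (c χ : ℂ) • z := by
  classical
  have : (LinearEquiv.ofBijective _ (isInternal 𝔥)).symm z =
      DirectSum.lof ℂ (Weight ℂ 𝔥 𝔤) (fun χ => (rootSpace 𝔥 χ).toSubmodule) χ ⟨z, hz⟩ := by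
    rw [LinearEquiv.symm_apply_eq]
    simp
  rw [weightScale, LinearMap.comp_apply, LinearEquiv.coe_coe, this, DirectSum.toModule_lof]
  simp

lemma weight_induction (𝔥 : LieSubalgebra ℂ 𝔤) [𝔥.IsCartanSubalgebra] {p : 𝔤 → Prop}
    (mem : ∀ (χ : Weight ℂ 𝔥 𝔤) (z), z ∈ rootSpace 𝔥 χ → p z) (zero : p 0)
    (add : ∀ x y, p x → p y → p (x + y)) (z : 𝔤) : p z := by
  have hz : z ∈ ⨆ χ : Weight ℂ 𝔥 𝔤, (rootSpace 𝔥 χ).toSubmodule := by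
    rw [LieSubmodule.iSup_toSubmodule_eq_top.mpr (iSup_genWeightSpace_eq_top' ℂ 𝔥 𝔤)]
    trivial
  exact Submodule.iSup_induction (motive := p) _ hz mem zero add

variable {b : (rootSystem 𝔥).Base}

open Classical in
/-- `ε`, extended by `1` outside of `Q⁺`. -/
def RealChar.ext (ε : RealChar b) (φ : Module.Dual ℂ 𝔥) : ℝ :=
  if h : φ ∈ QPlus b then ε (Multiplicative.ofAdd ⟨φ, h⟩) else 1

/-- `S_ε⁺`: multiplication by `ε_α` on the root space of each positive root `α`, and the identity
on `𝔥 + 𝔫⁻`. -/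
def SPlus (ε : RealChar b) : 𝔤 →ₗ[ℂ] 𝔤 := weightScale fun χ : Weight ℂ 𝔥 𝔤 => ε.ext χ.toLinear

/-- `S_ε⁻`: multiplication by `ε_α` on the root space of `-α` for each positive root `α`, and the
identity on `𝔥 + 𝔫⁺`. -/
def SMinus (ε : RealChar b) : 𝔤 →ₗ[ℂ] 𝔤 :=
  weightScale fun χ : Weight ℂ 𝔥 𝔤 => ε.ext (-χ.toLinear)

lemma QPlus_repr {φ : Module.Dual ℂ 𝔥} (h : φ ∈ QPlus b) (r : b.support) :
    ∃ n : ℕ, b.toWeightBasis.repr φ r = n := by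
  induction h using AddSubmonoid.closure_induction with
  | mem x hx =>
    obtain ⟨s, hs, rfl⟩ := hx
    have := b.toWeightBasis_repr_root ⟨s, hs⟩
    simp only at this
    rw [this]
    classical
    rw [Finsupp.single_apply]
    split_ifs
    · exact ⟨1, by simp⟩
    · exact ⟨0, by simp⟩
  | zero => exact ⟨0, by simp⟩
  | add x y _ _ hx hy =>
    obtain ⟨m, hm⟩ := hx
    obtain ⟨n, hn⟩ := hy
    exact ⟨m + n, by simp [hm, hn]⟩

lemma QPlus_pointed {φ : Module.Dual ℂ 𝔥} (h : φ ∈ QPlus b) (h' : -φ ∈ QPlus b) : φ = 0 := by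
  apply b.toWeightBasis.repr.injective
  ext r
  obtain ⟨m, hm⟩ := QPlus_repr h r
  obtain ⟨n, hn⟩ := QPlus_repr h' r
  have : ((m + n : ℕ) : ℂ) = 0 := by
    rw [Nat.cast_add, ← hm, ← hn]; simp
  have h0 : m = 0 := by
    have := Nat.cast_eq_zero.1 this
    omega
  simp [hm, h0]

lemma RealChar.ext_of_mem (ε : RealChar b) {φ : Module.Dual ℂ 𝔥} (h : φ ∈ QPlus b) :
    ε.ext φ = ε (Multiplicative.ofAdd ⟨φ, h⟩) := dif_pos h

lemma RealChar.ext_zero (ε : RealChar b) : ε.ext 0 = 1 := by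
  rw [ε.ext_of_mem (zero_mem _)]
  exact ε.map_one

lemma RealChar.ext_add (ε : RealChar b) {φ ψ : Module.Dual ℂ 𝔥} (h : φ ∈ QPlus b)
    (h' : ψ ∈ QPlus b) : ε.ext (φ + ψ) = ε.ext φ * ε.ext ψ := by
  rw [ε.ext_of_mem h, ε.ext_of_mem h', ε.ext_of_mem (add_mem h h'), ← ε.map_mul]
  rfl

lemma RealChar.ext_of_neg_mem (ε : RealChar b) {φ : Module.Dual ℂ 𝔥} (h : -φ ∈ QPlus b) :
    ε.ext φ = 1 := by
  by_cases h' : φ ∈ QPlus b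
  · rw [QPlus_pointed h' h, ε.ext_zero]
  · exact dif_neg h'

lemma SPlus_pos (ε : RealChar b) (α : PosRoot b) {z : 𝔤} (hz : z ∈ rootSpace 𝔥 α.1.1) :
    SPlus ε z = (ε.at α : ℂ) • z := by
  rw [SPlus, weightScale_apply _ α.1.1 hz, RealChar.at]
  rw [ε.ext_of_mem (φ := α.1.1.toLinear) α.2]
  rfl

lemma SPlus_neg (ε : RealChar b) (α : PosRoot b) {z : 𝔤} (hz : z ∈ rootSpace 𝔥 (-α.1.1)) :
    SPlus ε z = z := by
  rw [SPlus, weightScale_apply _ (-α.1.1) hz, ε.ext_of_neg_mem]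
  · simp
  · simpa using α.2

lemma SPlus_cartan (ε : RealChar b) {z : 𝔤} (hz : z ∈ 𝔥) : SPlus ε z = z := by
  by_cases h0 : z = 0
  · simp [h0]
  have hz' : z ∈ rootSpace 𝔥 (0 : 𝔥 → ℂ) := by
    rw [rootSpace_zero_eq]; simpa using hz
  let γ : Weight ℂ 𝔥 𝔤 := ⟨0, fun h => h0 (by rw [show rootSpace 𝔥 (0 : 𝔥 → ℂ) = ⊥ from h] at hz'; simpa using hz')⟩
  have hγ : γ.toLinear = 0 := by ext; simp [γ]
  rw [SPlus, weightScale_apply _ γ hz', hγ, ε.ext_zero]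
  simp

lemma SMinus_neg (ε : RealChar b) (α : PosRoot b) {z : 𝔤} (hz : z ∈ rootSpace 𝔥 (-α.1.1)) :
    SMinus ε z = (ε.at α : ℂ) • z := by
  rw [SMinus, weightScale_apply _ (-α.1.1) hz, RealChar.at]
  rw [Weight.toLinear_neg, neg_neg, ε.ext_of_mem (φ := α.1.1.toLinear) α.2]
  rfl

lemma SMinus_pos (ε : RealChar b) (α : PosRoot b) {z : 𝔤} (hz : z ∈ rootSpace 𝔥 α.1.1) :
    SMinus ε z = z := by
  rw [SMinus, weightScale_apply _ (α.1.1) hz, ε.ext_of_neg_mem]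
  · simp
  · simpa using α.2

lemma SMinus_cartan (ε : RealChar b) {z : 𝔤} (hz : z ∈ 𝔥) : SMinus ε z = z := by
  by_cases h0 : z = 0
  · simp [h0]
  have hz' : z ∈ rootSpace 𝔥 (0 : 𝔥 → ℂ) := by
    rw [rootSpace_zero_eq]; simpa using hz
  let γ : Weight ℂ 𝔥 𝔤 := ⟨0, fun h => h0 (by rw [show rootSpace 𝔥 (0 : 𝔥 → ℂ) = ⊥ from h] at hz'; simpa using hz')⟩
  have hγ : γ.toLinear = 0 := by ext; simp [γ]
  rw [SMinus, weightScale_apply _ γ hz', hγ, neg_zero, ε.ext_zero]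
  simp

lemma weight_cases (b : (rootSystem 𝔥).Base) (χ : Weight ℂ 𝔥 𝔤) :
    χ.toLinear ∈ QPlus b ∨ -χ.toLinear ∈ QPlus b := by
  by_cases h : χ.IsZero
  · left
    have : χ.toLinear = 0 := by ext x; simp [h.eq]
    rw [this]; exact zero_mem _
  · exact b.root_mem_or_neg_mem ⟨χ, by simpa using h⟩

lemma ext_pair_aux (ε : RealChar b) {φ ψ : Module.Dual ℂ 𝔥} (h1 : φ ∈ QPlus b)
    (h2 : -ψ ∈ QPlus b) (h3 : φ + ψ ∈ QPlus b ∨ -(φ + ψ) ∈ QPlus b) :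
    ∃ t : ℝ, ε.ext φ * ε.ext ψ = t * ε.ext (φ + ψ) ∧
      ε.ext (-φ) * ε.ext (-ψ) = t * ε.ext (-(φ + ψ)) := by
  have e1 : ε.ext (-φ) = 1 := ε.ext_of_neg_mem (by simpa using h1)
  have e2 : ε.ext ψ = 1 := ε.ext_of_neg_mem h2
  rcases h3 with h3 | h3
  · refine ⟨ε.ext (-ψ), ?_, ?_⟩
    · have := ε.ext_add h2 h3
      rw [neg_add_eq_sub, add_sub_cancel_right] at this
      rw [e2, mul_one, this]
    · rw [e1, one_mul, ε.ext_of_neg_mem (φ := -(φ + ψ)) (by simpa using h3), mul_one]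
  · refine ⟨ε.ext φ, ?_, ?_⟩
    · rw [e2, ε.ext_of_neg_mem h3]
    · have := ε.ext_add h1 h3
      rw [neg_add, add_neg_cancel_left] at this
      rw [e1, one_mul, this, neg_add]

lemma ext_pair (ε : RealChar b) {φ ψ : Module.Dual ℂ 𝔥}
    (h1 : φ ∈ QPlus b ∨ -φ ∈ QPlus b) (h2 : ψ ∈ QPlus b ∨ -ψ ∈ QPlus b)
    (h3 : φ + ψ ∈ QPlus b ∨ -(φ + ψ) ∈ QPlus b) :
    ∃ t : ℝ, ε.ext φ * ε.ext ψ = t * ε.ext (φ + ψ) ∧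
      ε.ext (-φ) * ε.ext (-ψ) = t * ε.ext (-(φ + ψ)) := by
  rcases h1 with h1 | h1 <;> rcases h2 with h2 | h2
  · refine ⟨1, by rw [ε.ext_add h1 h2, one_mul], ?_⟩
    rw [ε.ext_of_neg_mem (φ := -φ) (by simpa using h1),
      ε.ext_of_neg_mem (φ := -ψ) (by simpa using h2),
      ε.ext_of_neg_mem (φ := -(φ + ψ)) (by simpa using add_mem h1 h2), one_mul]
  · exact ext_pair_aux ε h1 h2 h3
  · rw [add_comm φ ψ] at h3 ⊢
    obtain ⟨t, ht, ht'⟩ := ext_pair_aux ε h2 h1 h3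
    exact ⟨t, by rw [mul_comm, ht], by rw [mul_comm, ht']⟩
  · refine ⟨1, ?_, by rw [neg_add, ε.ext_add h1 h2, one_mul]⟩
    rw [ε.ext_of_neg_mem h1, ε.ext_of_neg_mem h2,
      ε.ext_of_neg_mem (φ := φ + ψ) (by rw [neg_add]; exact add_mem h1 h2)]

lemma lie_range (ε : RealChar b) (z w : 𝔤) :
    ∃ u, SPlus ε u = ⁅SPlus ε z, SPlus ε w⁆ ∧ SMinus ε u = ⁅SMinus ε z, SMinus ε w⁆ := by
  induction z using weight_induction 𝔥 with
  | zero => exact ⟨0, by simp⟩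
  | add x y hx hy =>
    obtain ⟨u, hu, hu'⟩ := hx
    obtain ⟨v, hv, hv'⟩ := hy
    exact ⟨u + v, by simp [hu, hv], by simp [hu', hv']⟩
  | mem χ z hz =>
    induction w using weight_induction 𝔥 with
    | zero => exact ⟨0, by simp⟩
    | add x y hx hy =>
      obtain ⟨u, hu, hu'⟩ := hx
      obtain ⟨v, hv, hv'⟩ := hy
      exact ⟨u + v, by simp [hu, hv], by simp [hu', hv']⟩
    | mem ψ w hw =>
      have hzw := lie_mem_genWeightSpace_of_mem_genWeightSpace hz hw
      simp only [SPlus, SMinus, weightScale_apply _ χ hz, weightScale_apply _ ψ hw]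
      by_cases h0 : ⁅z, w⁆ = 0
      · exact ⟨0, by rw [smul_lie, lie_smul, h0]; simp, by rw [smul_lie, lie_smul, h0]; simp⟩
      let γ : Weight ℂ 𝔥 𝔤 := ⟨χ + ψ, fun h => h0 (by rw [h] at hzw; simpa using hzw)⟩
      have hγ : γ.toLinear = χ.toLinear + ψ.toLinear := by ext; simp [γ]
      have h3 := weight_cases b γ
      rw [hγ] at h3
      obtain ⟨t, ht, ht'⟩ := ext_pair ε (weight_cases b χ) (weight_cases b ψ) h3
      refine ⟨(t : ℂ) • ⁅z, w⁆, ?_, ?_⟩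
      · rw [_root_.map_smul, weightScale_apply _ γ hzw, smul_lie, lie_smul, smul_smul, smul_smul, hγ]
        congr 1
        exact_mod_cast ht.symm
      · rw [_root_.map_smul, weightScale_apply _ γ hzw, smul_lie, lie_smul, smul_smul, smul_smul, hγ]
        congr 1
        exact_mod_cast ht'.symm

/-- The Lie subalgebra `𝔤_ε = {(S_ε⁺ z, S_ε⁻ z) | z ∈ 𝔤}` of `𝔤 ⊕ 𝔤`. -/
def gEps (ε : RealChar b) : LieSubalgebra ℂ (𝔤 × 𝔤) where
  toSubmodule := LinearMap.range ((SPlus ε).prod (SMinus ε))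
  lie_mem' := by
    rintro _ _ ⟨z, rfl⟩ ⟨w, rfl⟩
    obtain ⟨u, hu, hu'⟩ := lie_range ε z w
    exact ⟨u, Prod.ext hu hu'⟩

lemma mem_gEps (ε : RealChar b) (x : 𝔤 × 𝔤) :
    x ∈ gEps ε ↔ ∃ z : 𝔤, (SPlus ε z, SMinus ε z) = x := Iff.rfl

/-- A choice of root vectors `X_α^± ∈ 𝔫^±` for the positive roots `α` which is adapted to the
involution `dag`, and with `[X_r⁺, X_r⁻] = h_r` (the coroot of `α_r`) for the simple roots. -/
structure RootVectors (b : (rootSystem 𝔥).Base) (dag : LieInvolution 𝔤) where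
  Xp : PosRoot b → 𝔤
  Xm : PosRoot b → 𝔤
  Xp_mem : ∀ α, Xp α ∈ rootSpace 𝔥 α.1.1
  Xm_mem : ∀ α, Xm α ∈ rootSpace 𝔥 (-α.1.1)
  Xp_ne_zero : ∀ α, Xp α ≠ 0
  Xm_ne_zero : ∀ α, Xm α ≠ 0
  dag_Xp : ∀ α, dag (Xp α) = Xm α
  lie_simple : ∀ r : b.support,
    ⁅Xp (simple b r), Xm (simple b r)⁆ = ((rootSystem 𝔥).coroot r : 𝔤)

namespace RootVectors

variable {dag : LieInvolution 𝔤}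

lemma dag_Xm (X : RootVectors b dag) (α : PosRoot b) : dag (X.Xm α) = X.Xp α := by
  rw [← X.dag_Xp, dag.apply_apply]

lemma dag_coroot (X : RootVectors b dag) (r : b.support) :
    dag ((rootSystem 𝔥).coroot r : 𝔤) = ((rootSystem 𝔥).coroot r : 𝔤) := by
  rw [← X.lie_simple, dag.map_lie, X.dag_Xp, X.dag_Xm]

lemma dag_cartan (X : RootVectors b dag) (h : 𝔥) : dag (h : 𝔤) ∈ 𝔥 := by
  have : h ∈ Submodule.span ℂ (Set.range b.toCoweightBasis) := by
    rw [b.toCoweightBasis.span_eq]; trivial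
  induction this using Submodule.span_induction with
  | mem x hx =>
    obtain ⟨r, rfl⟩ := hx
    rw [b.toCoweightBasis_apply, X.dag_coroot]
    exact Subtype.property _
  | zero => simp [dag.map_zero]
  | add x y _ _ hx hy =>
    change dag ((x : 𝔤) + y) ∈ 𝔥
    rw [dag.map_add]
    exact add_mem hx hy
  | smul c x _ hx =>
    change dag (c • (x : 𝔤)) ∈ 𝔥
    rw [dag.map_smul]
    exact 𝔥.smul_mem _ hx

lemma dag_mem (X : RootVectors b dag) (χ : Weight ℂ 𝔥 𝔤) {z : 𝔤} (hz : z ∈ rootSpace 𝔥 χ) :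
    dag z ∈ rootSpace 𝔥 (-χ) := by
  by_cases h : χ.IsZero
  · have h1 : (χ : 𝔥 → ℂ) = 0 := h.eq
    rw [h1] at hz
    rw [h1, neg_zero]
    rw [rootSpace_zero_eq] at hz ⊢
    exact X.dag_cartan ⟨z, by simpa using hz⟩
  · have h1 : χ.IsNonZero := h
    rcases weight_cases b χ with hχ | hχ
    · let α : PosRoot b := ⟨⟨χ, by simpa using h⟩, hχ⟩
      obtain ⟨c, hc⟩ := (finrank_eq_one_iff_of_nonzero' (⟨X.Xp α, X.Xp_mem α⟩ : rootSpace 𝔥 χ)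
        (fun h => X.Xp_ne_zero α (congrArg Subtype.val h))).1
        (finrank_rootSpace_eq_one χ h1) ⟨z, hz⟩
      have hc' : c • X.Xp α = z := congrArg Subtype.val hc
      rw [← hc', dag.map_smul, X.dag_Xp]
      exact Submodule.smul_mem _ _ (X.Xm_mem α)
    · let α : PosRoot b := ⟨⟨-χ, by simpa using h⟩, by simpa using hχ⟩
      have hm : X.Xm α ∈ rootSpace 𝔥 χ := by simpa [α] using X.Xm_mem α
      obtain ⟨c, hc⟩ := (finrank_eq_one_iff_of_nonzero' (⟨X.Xm α, hm⟩ : rootSpace 𝔥 χ)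
        (fun h => X.Xm_ne_zero α (congrArg Subtype.val h))).1
        (finrank_rootSpace_eq_one χ h1) ⟨z, hz⟩
      have hc' : c • X.Xm α = z := congrArg Subtype.val hc
      rw [← hc', dag.map_smul, X.dag_Xm]
      exact Submodule.smul_mem _ _ (X.Xp_mem α)

lemma dag_SPlus (X : RootVectors b dag) (ε : RealChar b) (z : 𝔤) : dag (SPlus ε z) = SMinus ε (dag z) := by
  induction z using weight_induction 𝔥 with
  | zero => simp [dag.map_zero]
  | add x y hx hy => simp only [_root_.map_add, dag.map_add, hx, hy]
  | mem χ z hz =>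
    have h2 : dag z ∈ rootSpace 𝔥 (-χ : Weight ℂ 𝔥 𝔤) := X.dag_mem χ hz
    rw [SPlus, SMinus, weightScale_apply _ χ hz, weightScale_apply _ (-χ) h2, dag.map_smul,
      Weight.toLinear_neg, neg_neg, Complex.conj_ofReal]

lemma dag_SMinus (X : RootVectors b dag) (ε : RealChar b) (z : 𝔤) : dag (SMinus ε z) = SPlus ε (dag z) := by
  rw [← dag.apply_apply (SPlus ε (dag z)), X.dag_SPlus, dag.apply_apply]

lemma swap_mem (X : RootVectors b dag) (ε : RealChar b) : ∀ x ∈ gEps ε, dag.swap x ∈ gEps ε := by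
  rintro _ ⟨z, rfl⟩
  exact ⟨dag z, Prod.ext (X.dag_SMinus ε z).symm (X.dag_SPlus ε z).symm⟩

/-- The `*`-operation on `𝔤_ε`: the restriction of `(w, z) ↦ (z†, w†)`. -/
def star (X : RootVectors b dag) (ε : RealChar b) : LieInvolution (gEps ε) :=
  dag.swap.restrict (gEps ε) (X.swap_mem ε)

end RootVectors

end Contraction

end

end EpsLie

/-! The elements of `gEps ε` attached to the simple root vectors and coroots satisfy the defining
relations, because each coordinate only rescales some of the Chevalley generators of `𝔤`. This gives
a homomorphism `F` from the presented algebra (`RootVectors.exists_hom`), compatible with the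
involutions because it is so on generators. `F` is bijective because it is surjective and its source
has dimension at most that of its target.

Surjectivity (`lieSubalgebra_eq_top`): on `𝔫⁺` the parametrization `z ↦ (S⁺z, S⁻z)` is a Lie
homomorphism, since `S⁺` is multiplicative there and `S⁻` is the identity. Every positive root
vector is reached from the simple ones by powers of `ad X_r⁺`, the involution gives the negative
ones, and the coroots span `𝔥`.

Dimension bound: the presented algebra is spanned by the `H_r` and the iterated brackets of the
`X_r⁺` alone and of the `X_r⁻` alone (`span_monomials_eq_top`). It remains to see that brackets of
multidegree `β` span at most a line, and vanish unless `β` is a root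
(`gradedPart_root_multiplicity`). The usual argument reflects weights by an action of `𝔰𝔩₂`, but
when `ε_r = 0` the elements `X_r^±` commute and no such action is at hand. What survives is the
Serre relations, so the `𝔰𝔩₂` structure is put on a cover: each `x_s` with `s ≠ r` is the image of
the lowest vector of a finite string, an iterated bracket is the image of a tensor product of
strings, and the map down respects only the raising operator. That is enough: upstairs `e ^ k` maps
weight `-k` onto weight `k`, so degree `β` of weight `k ≥ 0` is the image under `ad(x_r)^k` of
degree `β - k α_r`. Induction on the sum of the coefficients of `β` finishes, because a nonzero
nonnegative `β` pairs positively with some simple coroot. -/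

namespace EpsLie

open LieAlgebra LieAlgebra.IsKilling LieModule

noncomputable section

/-! ### Graded `𝔰𝔩₂` operators and the surjectivity of `e ^ k` -/

section Sl2

open Polynomial

variable {K W : Type*} [Field K] [AddCommGroup W] [Module K W]

/-- Operators `e`, `f` of degrees `1`, `-1` on a family of submodules indexed by `ℤ`, which satisfy
the `𝔰𝔩₂` relation `[e, f] = k + 2 i` on the `i`-th submodule. -/
structure GradedSl2 (e f : Module.End K W) (G : ℤ → Submodule K W) (k : ℤ) : Prop where
  e_mem : ∀ i, ∀ w ∈ G i, e w ∈ G (i + 1)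
  f_mem : ∀ i, ∀ w ∈ G i, f w ∈ G (i - 1)
  lie_e_f : ∀ i, ∀ w ∈ G i, e (f w) - f (e w) = ((k + 2 * i : ℤ) : K) • w

namespace GradedSl2

variable {e f : Module.End K W} {G : ℤ → Submodule K W} {k : ℤ}

lemma e_pow_mem (h : GradedSl2 e f G k) {i : ℤ} {w : W} (hw : w ∈ G i) (m : ℕ) :
    (e ^ m) w ∈ G (i + m) := by
  induction m with
  | zero => simpa using hw
  | succ m ih =>
    rw [pow_succ', Module.End.mul_apply]
    have := h.e_mem _ _ ih
    rwa [add_assoc] at this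

lemma f_pow_mem (h : GradedSl2 e f G k) {i : ℤ} {w : W} (hw : w ∈ G i) (m : ℕ) :
    (f ^ m) w ∈ G (i - m) := by
  induction m with
  | zero => simpa using hw
  | succ m ih =>
    rw [pow_succ', Module.End.mul_apply]
    have := h.f_mem _ _ ih
    rw [sub_sub] at this
    exact_mod_cast this

/-- Moving `f` past one more `e` costs the weight of the vector reached. The scalar is the sum of `k
+ 2i` for `1 ≤ i ≤ m`. -/
lemma f_e_e_pow (h : GradedSl2 e f G k) {w : W} (hw : w ∈ G 0) (m : ℕ) :
    f (e ((e ^ m) w)) = (e ^ m) (f (e w)) - ((m * (k + m + 1) : ℤ) : K) • (e ^ m) w := by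
  induction m with
  | zero => simp
  | succ m ih =>
    have h1 := h.lie_e_f _ _ (h.e_pow_mem hw (m + 1))
    rw [sub_eq_iff_eq_add, ← sub_eq_iff_eq_add'] at h1
    rw [← h1]
    simp only [pow_succ' e m, Module.End.mul_apply, ih, map_sub, map_smul]
    push_cast
    module

/-- Here the scalar is the sum of the weights `k - 2i` for `0 ≤ i ≤ m`. The right side is again
written through `f e`, so that both families of products become polynomials in one operator. -/
lemma e_f_f_pow (h : GradedSl2 e f G k) {w : W} (hw : w ∈ G 0) (m : ℕ) :
    e (f ((f ^ m) w)) = (f ^ m) (f (e w)) + (((m + 1) * (k - m) : ℤ) : K) • (f ^ m) w := by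
  induction m with
  | zero =>
    have h1 := h.lie_e_f _ _ hw
    rw [sub_eq_iff_eq_add'] at h1
    simpa using h1
  | succ m ih =>
    have h1 := h.lie_e_f _ _ (h.f_pow_mem hw (m + 1))
    rw [sub_eq_iff_eq_add'] at h1
    rw [h1]
    simp only [pow_succ' f m, Module.End.mul_apply, ih, map_add, map_smul]
    push_cast
    module

lemma aeval_mem (h : GradedSl2 e f G k) {w : W} (hw : w ∈ G 0) (p : K[X]) :
    aeval (f * e) p w ∈ G 0 := by
  induction p using Polynomial.induction_on' with
  | add p q hp hq => simpa using add_mem hp hq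
  | monomial n a =>
    rw [aeval_monomial, Module.End.mul_apply, Module.algebraMap_end_apply]
    refine (G 0).smul_mem _ ?_
    induction n with
    | zero => simpa using hw
    | succ n ih =>
      rw [pow_succ', Module.End.mul_apply]
      simpa using h.f_mem _ _ (h.e_mem _ _ ih)

lemma f_pow_e_pow (h : GradedSl2 e f G k) (m : ℕ) : ∀ w ∈ G 0, (f ^ m) ((e ^ m) w) =
    aeval (f * e) (∏ j ∈ Finset.range m, (X - C ((j * (k + j + 1) : ℤ) : K))) w := by
  induction m with
  | zero => simp
  | succ m ih =>
    intro w hw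
    have h1 : aeval (f * e) (X - C ((m * (k + m + 1) : ℤ) : K)) w =
        f (e w) - ((m * (k + m + 1) : ℤ) : K) • w := by
      rw [map_sub, aeval_X, aeval_C]
      rfl
    rw [Finset.prod_range_succ, map_mul, Module.End.mul_apply,
      ← ih _ (h.aeval_mem hw _), pow_succ f, pow_succ' e, Module.End.mul_apply,
      Module.End.mul_apply, h.f_e_e_pow hw, h1, map_sub (e ^ m), map_smul (e ^ m)]

lemma e_pow_f_pow (h : GradedSl2 e f G k) (m : ℕ) : ∀ w ∈ G 0, (e ^ m) ((f ^ m) w) =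
    aeval (f * e) (∏ j ∈ Finset.range m, (X - C ((-((j + 1) * (k - j)) : ℤ) : K))) w := by
  induction m with
  | zero => simp
  | succ m ih =>
    intro w hw
    have h1 : aeval (f * e) (X - C ((-((m + 1) * (k - m)) : ℤ) : K)) w =
        f (e w) + (((m + 1) * (k - m) : ℤ) : K) • w := by
      rw [Int.cast_neg, C_neg, sub_neg_eq_add]
      rw [map_add, aeval_X, aeval_C]
      rfl
    rw [Finset.prod_range_succ, map_mul, Module.End.mul_apply,
      ← ih _ (h.aeval_mem hw _), pow_succ e, pow_succ' f, Module.End.mul_apply,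
      Module.End.mul_apply, h.e_f_f_pow hw, h1, map_add (f ^ m), map_smul (f ^ m)]

/-- If `e` is nilpotent, then `e ^ k` maps onto the weight space of weight `k ≥ 0`. -/
lemma exists_e_pow_eq [CharZero K] {k : ℕ} (h : GradedSl2 e f G k) (he : IsNilpotent e) {w : W}
    (hw : w ∈ G 0) : ∃ u ∈ G (-k), (e ^ k) u = w := by
  obtain ⟨M, hM⟩ := he
  -- `P(fe) = f^M e^M` kills `w`, while `Q(fe) = e^k f^k` on degree `0`. The roots of `P` are
  -- nonnegative and those of `Q` negative, so a Bézout relation gives `w = Q(fe) q(fe) w`, which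
  -- lies in the image of `e ^ k`.
  set P : K[X] := ∏ j ∈ Finset.range M, (X - C ((j * (k + j + 1) : ℤ) : K))
  set Q : K[X] := ∏ j ∈ Finset.range k, (X - C ((-((j + 1) * (k - j)) : ℤ) : K))
  have hPQ : IsCoprime P Q := by
    refine IsCoprime.prod_left fun i _ => IsCoprime.prod_right fun j hj => ?_
    apply isCoprime_X_sub_C_of_isUnit_sub
    rw [← Int.cast_sub, isUnit_iff_ne_zero, Int.cast_ne_zero]
    have hj' := Finset.mem_range.1 hj
    have h1 : (0 : ℤ) ≤ i * (k + i + 1) := by positivity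
    have h2 : (0 : ℤ) < (j + 1) * (k - j) := mul_pos (by positivity) (by omega)
    omega
  obtain ⟨p, q, hpq⟩ := hPQ
  have hP : aeval (f * e) P w = 0 := by
    rw [← h.f_pow_e_pow M w hw, hM]
    simp
  refine ⟨(f ^ k) (aeval (f * e) q w), ?_, ?_⟩
  · simpa using h.f_pow_mem (h.aeval_mem hw q) k
  · rw [h.e_pow_f_pow k _ (h.aeval_mem hw q), ← Module.End.mul_apply, ← map_mul]
    calc aeval (f * e) (Q * q) w = aeval (f * e) (p * P + q * Q) w := by
          rw [map_add, LinearMap.add_apply, map_mul _ p, Module.End.mul_apply, hP, map_zero,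
            zero_add, mul_comm]
      _ = w := by rw [hpq]; simp

end GradedSl2

end Sl2

/-! ### Multigraded brackets and their `𝔰𝔩₂` covers -/

section Graded

open TensorProduct

universe u

variable {I : Type*} {K : Type u} {L : Type*} [Field K] [LieRing L] [LieAlgebra K L]

/-- Iterated brackets of the elements `x r`, together with their multidegree. -/
inductive IsMonomial [DecidableEq I] (x : I → L) : (I → ℤ) → L → Prop
  | gen (r : I) : IsMonomial x (Pi.single r 1) (x r)
  | lie {β γ : I → ℤ} {y z : L} (hy : IsMonomial x β y) (hz : IsMonomial x γ z) :
      IsMonomial x (β + γ) ⁅y, z⁆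

variable (K) in
/-- The span of the iterated brackets of multidegree `β`. -/
def gradedPart [DecidableEq I] (x : I → L) (β : I → ℤ) : Submodule K L :=
  Submodule.span K {y | IsMonomial x β y}

lemma lie_mem_span {s t u : Set L} (h : ∀ y ∈ s, ∀ z ∈ t, ⁅y, z⁆ ∈ Submodule.span K u) {y z : L}
    (hy : y ∈ Submodule.span K s) (hz : z ∈ Submodule.span K t) :
    ⁅y, z⁆ ∈ Submodule.span K u := by
  induction hy using Submodule.span_induction with
  | mem y hy =>
    induction hz using Submodule.span_induction with
    | mem z hz => exact h y hy z hz
    | zero => simp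
    | add z z' _ _ hz hz' => rw [lie_add]; exact add_mem hz hz'
    | smul c z _ hz => rw [lie_smul]; exact Submodule.smul_mem _ c hz
  | zero => simp
  | add y y' _ _ hy hy' => rw [add_lie]; exact add_mem hy hy'
  | smul c y _ hy => rw [smul_lie]; exact Submodule.smul_mem _ c hy

variable [DecidableEq I] {x : I → L}

lemma gen_mem_gradedPart (r : I) : x r ∈ gradedPart K x (Pi.single r 1) :=
  Submodule.subset_span (.gen r)

lemma lie_mem_gradedPart {β γ : I → ℤ} {y z : L} (hy : y ∈ gradedPart K x β)
    (hz : z ∈ gradedPart K x γ) : ⁅y, z⁆ ∈ gradedPart K x (β + γ) :=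
  lie_mem_span (fun _ hy _ hz => Submodule.subset_span (.lie hy hz)) hy hz

lemma ad_pow_mem_gradedPart (r s : I) (n : ℕ) :
    ((ad K L (x r)) ^ n) (x s) ∈
      gradedPart K x (Pi.single s 1 + (n : ℤ) • Pi.single r (1 : ℤ)) := by
  induction n with
  | zero => simpa using gen_mem_gradedPart s
  | succ n ih =>
    rw [pow_succ', Module.End.mul_apply, ad_apply]
    convert lie_mem_gradedPart (gen_mem_gradedPart r) ih using 2
    push_cast
    module

lemma IsMonomial.nonneg {β : I → ℤ} {y : L} (h : IsMonomial x β y) : 0 ≤ β := by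
  induction h with
  | gen r => exact Pi.single_nonneg.2 zero_le_one
  | lie _ _ h1 h2 => exact add_nonneg h1 h2

lemma IsMonomial.one_le_sum [Fintype I] {β : I → ℤ} {y : L} (h : IsMonomial x β y) :
    1 ≤ ∑ i, β i := by
  induction h with
  | gen r => simp
  | lie _ _ h1 h2 => simp only [Pi.add_apply, Finset.sum_add_distrib]; omega

lemma IsMonomial.eq_gen [Fintype I] {β : I → ℤ} {y : L} (h : IsMonomial x β y)
    (hβ : ∑ i, β i = 1) : ∃ r, β = Pi.single r 1 ∧ y = x r := by
  cases h with
  | gen r => exact ⟨r, rfl, rfl⟩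
  | lie h1 h2 =>
    simp only [Pi.add_apply, Finset.sum_add_distrib] at hβ
    have := h1.one_le_sum
    have := h2.one_le_sum
    omega

variable (K) in
/-- A graded module with operators `e`, `f` as in `GradedSl2` (and `e` nilpotent), mapping to `L`
in such a way that `e` becomes the bracket with `x r`, and degree `i` becomes multidegree
`β + i α_r`. The starting weight is `k`. -/
structure Sl2Cover (x : I → L) (r : I) (β : I → ℤ) (k : ℤ) where
  W : Type u
  [group : AddCommGroup W]
  [module : Module K W]
  e : Module.End K W
  f : Module.End K W
  G : ℤ → Submodule K W
  gradedSl2 : GradedSl2 e f G k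
  nilpotent : IsNilpotent e
  φ : W →ₗ[K] L
  φ_e : ∀ w, φ (e w) = ⁅x r, φ w⁆
  φ_mem : ∀ i, ∀ w ∈ G i, φ w ∈ gradedPart K x (β + i • Pi.single r 1)

attribute [instance] Sl2Cover.group Sl2Cover.module

namespace Sl2Cover

variable {r : I} {β γ : I → ℤ} {k l : ℤ}

/-- Moving the origin of the grading by `1`. -/
def shift (S : Sl2Cover K x r β k) : Sl2Cover K x r (Pi.single r 1 + β) (2 + k) where
  W := S.W
  e := S.e
  f := S.f
  G i := S.G (i + 1)
  gradedSl2 :=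
    { e_mem := fun i w hw => S.gradedSl2.e_mem _ w hw
      f_mem := fun i w hw => by
        have := S.gradedSl2.f_mem _ w hw
        rwa [add_sub_right_comm] at this
      lie_e_f := fun i w hw => by
        rw [S.gradedSl2.lie_e_f _ w hw]
        congr 2
        ring }
  nilpotent := S.nilpotent
  φ := S.φ
  φ_e := S.φ_e
  φ_mem i w hw := by
    convert S.φ_mem _ w hw using 2
    module

/-- The tensor product of two covers, mapped to `L` by the bracket. -/
def tensor (S : Sl2Cover K x r β k) (T : Sl2Cover K x r γ l) :
    Sl2Cover K x r (β + γ) (k + l) where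
  W := S.W ⊗[K] T.W
  e := S.e.rTensor T.W + T.e.lTensor S.W
  f := S.f.rTensor T.W + T.f.lTensor S.W
  G i := Submodule.span K {w | ∃ m n, m + n = i ∧ ∃ u ∈ S.G m, ∃ v ∈ T.G n, u ⊗ₜ v = w}
  gradedSl2 :=
    { e_mem := by
        intro i w hw
        induction hw using Submodule.span_induction with
        | mem w hw =>
          obtain ⟨m, n, rfl, u, hu, v, hv, rfl⟩ := hw
          simp only [LinearMap.add_apply, LinearMap.rTensor_tmul, LinearMap.lTensor_tmul]
          refine add_mem (Submodule.subset_span ⟨m + 1, n, by ring, _, S.gradedSl2.e_mem _ _ hu,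
            v, hv, rfl⟩) (Submodule.subset_span ⟨m, n + 1, by ring, u, hu, _,
              T.gradedSl2.e_mem _ _ hv, rfl⟩)
        | zero => simp
        | add u v _ _ hu hv => rw [map_add]; exact add_mem hu hv
        | smul c u _ hu => rw [map_smul]; exact Submodule.smul_mem _ c hu
      f_mem := by
        intro i w hw
        induction hw using Submodule.span_induction with
        | mem w hw =>
          obtain ⟨m, n, rfl, u, hu, v, hv, rfl⟩ := hw
          simp only [LinearMap.add_apply, LinearMap.rTensor_tmul, LinearMap.lTensor_tmul]
          refine add_mem (Submodule.subset_span ⟨m - 1, n, by ring, _, S.gradedSl2.f_mem _ _ hu,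
            v, hv, rfl⟩) (Submodule.subset_span ⟨m, n - 1, by ring, u, hu, _,
              T.gradedSl2.f_mem _ _ hv, rfl⟩)
        | zero => simp
        | add u v _ _ hu hv => rw [map_add]; exact add_mem hu hv
        | smul c u _ hu => rw [map_smul]; exact Submodule.smul_mem _ c hu
      lie_e_f := by
        intro i w hw
        induction hw using Submodule.span_induction with
        | mem w hw =>
          obtain ⟨m, n, rfl, u, hu, v, hv, rfl⟩ := hw
          simp only [LinearMap.add_apply, LinearMap.rTensor_tmul, LinearMap.lTensor_tmul,
            map_add]
          have h1 := congrArg (· ⊗ₜ[K] v) (S.gradedSl2.lie_e_f _ _ hu)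
          have h2 := congrArg (u ⊗ₜ[K] ·) (T.gradedSl2.lie_e_f _ _ hv)
          simp only [sub_tmul, tmul_sub, ← smul_tmul', tmul_smul] at h1 h2
          rw [sub_eq_iff_eq_add] at h1 h2
          rw [h1, h2]
          push_cast
          module
        | zero => simp
        | add u v _ _ hu hv => simp only [map_add, smul_add, ← hu, ← hv]; abel
        | smul c u _ hu => simp only [map_smul, ← smul_sub, hu, smul_comm c] }
  nilpotent := by
    refine Commute.isNilpotent_add ?_ ?_ ?_
    · rw [commute_iff_eq]
      ext u v
      simp
    · obtain ⟨n, hn⟩ := S.nilpotent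
      exact ⟨n, by rw [LinearMap.rTensor_pow, hn, LinearMap.rTensor_zero]⟩
    · obtain ⟨n, hn⟩ := T.nilpotent
      exact ⟨n, by rw [LinearMap.lTensor_pow, hn, LinearMap.lTensor_zero]⟩
  φ := TensorProduct.lift (LinearMap.mk₂ K (fun u v => ⁅S.φ u, T.φ v⁆) (by simp) (by simp) (by simp)
    (by simp))
  φ_e w := by
    induction w using TensorProduct.induction_on with
    | zero => simp
    | tmul u v => simp [S.φ_e, T.φ_e]
    | add u v hu hv => rw [map_add, map_add, hu, hv, map_add, lie_add]
  φ_mem i w hw := by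
    induction hw using Submodule.span_induction with
    | mem w hw =>
      obtain ⟨m, n, rfl, u, hu, v, hv, rfl⟩ := hw
      rw [TensorProduct.lift.tmul, LinearMap.mk₂_apply]
      convert lie_mem_gradedPart (S.φ_mem _ _ hu) (T.φ_mem _ _ hv) using 2
      module
    | zero => simp
    | add u v _ _ hu hv => rw [map_add]; exact add_mem hu hv
    | smul c u _ hu => rw [map_smul]; exact Submodule.smul_mem _ c hu

/-- The string through `x s`, under a Serre relation. -/
def string {s : I} {n : ℕ} (h : ((ad K L (x r)) ^ (n + 1)) (x s) = 0) :
    Sl2Cover K x r (Pi.single s 1) (-n) where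
  -- The basis vector `i ≤ n` stands for `ad(x_r)^i (x_s)` and has weight `-n + 2i`, as in the
  -- simple `𝔰𝔩₂`-module of dimension `n + 1`. The vectors with `i > n` lie in no `G j`, and `e`
  -- kills them. At `i = 0` the truncated index `i - 1` is harmless, as its coefficient is `0`.
  W := ℕ →₀ K
  e := Finsupp.linearCombination K fun i => if i < n then Finsupp.single (i + 1) 1 else 0
  f := Finsupp.linearCombination K fun i =>
    Finsupp.single (i - 1) ((i * (n - i + 1) : ℤ) : K)
  G j := Submodule.span K {w | ∃ i : ℕ, i = j ∧ i ≤ n ∧ Finsupp.single i 1 = w}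
  gradedSl2 :=
    { e_mem := by
        intro j w hw
        refine (Submodule.span_le (p := (Submodule.span K
          {w | ∃ i : ℕ, i = j + 1 ∧ i ≤ n ∧ Finsupp.single i (1 : K) = w}).comap _)).2 ?_ hw
        rintro _ ⟨i, rfl, hi, rfl⟩
        simp only [SetLike.mem_coe, Submodule.mem_comap, Finsupp.linearCombination_single,
          one_smul]
        split_ifs with h
        · exact Submodule.subset_span ⟨i + 1, by simp, h, rfl⟩
        · exact zero_mem _
      f_mem := by
        intro j w hw
        refine (Submodule.span_le (p := (Submodule.span K
          {w | ∃ i : ℕ, i = j - 1 ∧ i ≤ n ∧ Finsupp.single i (1 : K) = w}).comap _)).2 ?_ hw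
        rintro _ ⟨i, rfl, hi, rfl⟩
        simp only [SetLike.mem_coe, Submodule.mem_comap, Finsupp.linearCombination_single,
          one_smul]
        rcases i with _ | i
        · simp
        · rw [← mul_one (Int.cast _), ← smul_eq_mul, ← Finsupp.smul_single]
          exact Submodule.smul_mem _ _ (Submodule.subset_span ⟨i, by simp, by omega, by simp⟩)
      lie_e_f := by
        intro j w hw
        induction hw using Submodule.span_induction with
        | mem w hw =>
          obtain ⟨i, rfl, hi, rfl⟩ := hw
          simp only [Finsupp.linearCombination_single, one_smul]
          have h1 : (if i < n then Finsupp.single (i + 1) (1 : K) else 0) =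
              Finsupp.single (i + 1) (if i < n then 1 else 0) := by split_ifs <;> simp
          rw [h1]
          simp only [Finsupp.linearCombination_single, add_tsub_cancel_right,
            Finsupp.smul_single, smul_eq_mul, mul_one]
          rcases i with _ | i
          · rcases n with _ | n <;> simp
          · rw [if_pos (by omega), Nat.add_sub_cancel, Finsupp.smul_single, ← Finsupp.single_sub]
            congr 1
            rcases hi.lt_or_eq with hi | rfl
            · rw [if_pos hi]
              push_cast
              simp
              ring
            · simp
              ring
        | zero => simp
        | add u v _ _ hu hv => simp only [map_add, smul_add, ← hu, ← hv]; abel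
        | smul c u _ hu => simp only [map_smul, ← smul_sub, hu, smul_comm c] }
  nilpotent := by
    refine ⟨n + 1, Finsupp.lhom_ext' fun i => LinearMap.ext_ring ?_⟩
    -- The inner case `m = 0` is needed for the basis vectors beyond the end of the string, `i > n`.
    suffices ∀ m : ℕ, ((Finsupp.linearCombination K fun i => if i < n then
        Finsupp.single (i + 1) (1 : K) else 0) ^ m) (Finsupp.single i 1) =
        if i + m ≤ n then Finsupp.single (i + m) 1 else
        if m = 0 then Finsupp.single i 1 else 0 by
      simp only [LinearMap.comp_apply, Finsupp.lsingle_apply]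
      rw [this, if_neg (by omega), if_neg (by omega)]
      simp
    intro m
    induction m with
    | zero => simp
    | succ m ih =>
      rw [pow_succ', Module.End.mul_apply, ih]
      by_cases h1 : i + m < n
      · rw [if_pos h1.le, if_pos (by omega)]
        simp [h1, add_assoc]
      · rw [if_neg (by omega : ¬ i + (m + 1) ≤ n), if_neg (Nat.succ_ne_zero m)]
        split_ifs <;> simp <;> omega
  φ := Finsupp.linearCombination K fun i => ((ad K L (x r)) ^ i) (x s)
  φ_e w := by
    rw [← ad_apply (R := K), ← LinearMap.comp_apply, ← LinearMap.comp_apply]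
    congr 1
    refine Finsupp.lhom_ext' fun i => LinearMap.ext_ring ?_
    simp only [LinearMap.comp_apply, Finsupp.lsingle_apply, Finsupp.linearCombination_single,
      one_smul]
    split_ifs with hi
    · simp [pow_succ']
    · rw [map_zero, ← Module.End.mul_apply, ← pow_succ', ← Nat.sub_add_cancel
        (by omega : n + 1 ≤ i + 1), pow_add, Module.End.mul_apply, h, map_zero]
  φ_mem j w hw := by
    refine (Submodule.span_le (p := (gradedPart K x _).comap _)).2 ?_ hw
    rintro _ ⟨i, rfl, hi, rfl⟩
    simpa using ad_pow_mem_gradedPart r s i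

lemma exists_lie_pow_eq [CharZero K] {k : ℕ} (S : Sl2Cover K x r β k) {w : S.W} (hw : w ∈ S.G 0) :
    ∃ z ∈ gradedPart K x (β - (k : ℤ) • Pi.single r 1), ((ad K L (x r)) ^ k) z = S.φ w := by
  obtain ⟨u, hu, rfl⟩ := S.gradedSl2.exists_e_pow_eq S.nilpotent hw
  refine ⟨S.φ u, ?_, ?_⟩
  · convert S.φ_mem _ _ hu using 2
    module
  · have h (m : ℕ) : ((ad K L (x r)) ^ m) (S.φ u) = S.φ ((S.e ^ m) u) := by
      induction m with
      | zero => simp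
      | succ m ih =>
        rw [pow_succ', pow_succ', Module.End.mul_apply, Module.End.mul_apply, ih, S.φ_e, ad_apply]
    exact h k

end Sl2Cover

variable (K) in
/-- The span of the elements of `L` which are covered in the sense of `Sl2Cover`. -/
def coveredPart (x : I → L) (r : I) (β : I → ℤ) (k : ℤ) : Submodule K L :=
  Submodule.span K {z | ∃ S : Sl2Cover K x r β k, ∃ w ∈ S.G 0, S.φ w = z}

lemma lie_mem_coveredPart {r : I} {β γ : I → ℤ} {k l : ℤ} {y z : L}
    (hy : y ∈ coveredPart K x r β k) (hz : z ∈ coveredPart K x r γ l) :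
    ⁅y, z⁆ ∈ coveredPart K x r (β + γ) (k + l) := by
  refine lie_mem_span ?_ hy hz
  rintro _ ⟨S, u, hu, rfl⟩ _ ⟨T, v, hv, rfl⟩
  have h : u ⊗ₜ[K] v ∈ Submodule.span K {w | ∃ m n : ℤ, m + n = 0 ∧ ∃ u ∈ S.G m, ∃ v ∈ T.G n,
      u ⊗ₜ[K] v = w} := Submodule.subset_span ⟨0, 0, by simp, u, hu, v, hv, rfl⟩
  exact Submodule.subset_span ⟨S.tensor T, u ⊗ₜ[K] v, h, TensorProduct.lift.tmul u v⟩

/-- The element `x r` need not itself be covered, so `tensor` does not apply. Bracketing with it is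
the image of `e`, which raises the degree by one, and `shift` renames degree `1` as degree `0`. -/
lemma gen_lie_mem_coveredPart {r : I} {β : I → ℤ} {k : ℤ} {z : L}
    (hz : z ∈ coveredPart K x r β k) :
    ⁅x r, z⁆ ∈ coveredPart K x r (Pi.single r 1 + β) (2 + k) := by
  refine lie_mem_span (s := {x r}) ?_ (Submodule.mem_span_singleton_self _) hz
  rintro _ rfl _ ⟨S, u, hu, rfl⟩
  exact Submodule.subset_span ⟨S.shift, S.e u, S.gradedSl2.e_mem _ _ hu, S.φ_e u⟩

/-- The Serre relations for a matrix `A` with diagonal entries `2` and nonpositive off-diagonal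
entries. -/
structure SerreRelations (K : Type*) [Field K] [LieAlgebra K L] (A : Matrix I I ℤ) (x : I → L) :
    Prop where
  diag : ∀ r, A r r = 2
  nonpos : ∀ r s, r ≠ s → A r s ≤ 0
  serre : ∀ r s, r ≠ s → ((ad K L (x r)) ^ (1 - A r s).toNat) (x s) = 0

namespace SerreRelations

variable [Fintype I] {A : Matrix I I ℤ}

/-- Strings cover the generators `x s` with `s ≠ r`, and tensor products and shifts cover brackets.
The generator `x r` is the only exception: its bracket with itself vanishes, and its bracket with
anything covered is covered. -/
lemma mem_coveredPart (hx : SerreRelations K A x) (r : I) {β : I → ℤ} {z : L}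
    (hz : IsMonomial x β z) :
    z ∈ coveredPart K x r β (A.mulVec β r) ∨ (β = Pi.single r 1 ∧ z = x r) := by
  induction hz with
  | gen s =>
    rcases eq_or_ne r s with rfl | hrs
    · exact Or.inr ⟨rfl, rfl⟩
    · left
      have h := hx.serre r s hrs
      obtain ⟨n, hn⟩ := Int.eq_ofNat_of_zero_le (neg_nonneg.2 (hx.nonpos r s hrs))
      have hn' : A r s = -n := by omega
      rw [show (1 - A r s).toNat = n + 1 by omega] at h
      have h2 : A.mulVec (Pi.single s 1) r = -n := by simp [hn']
      rw [h2]
      have h3 : Finsupp.single 0 1 ∈ Submodule.span K {w : ℕ →₀ K | ∃ i : ℕ, (i : ℤ) = 0 ∧ i ≤ n ∧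
          Finsupp.single i 1 = w} := Submodule.subset_span ⟨0, by simp, by simp, rfl⟩
      exact Submodule.subset_span ⟨.string h, (Finsupp.single 0 1 : ℕ →₀ K), h3,
        (Finsupp.linearCombination_single K _ _).trans (by simp)⟩
  | @lie β γ y z _ _ hy hz =>
    have h1 : A.mulVec (β + γ) r = A.mulVec β r + A.mulVec γ r := by
      rw [Matrix.mulVec_add, Pi.add_apply]
    have h2 : A.mulVec (Pi.single r 1) r = 2 := by simp [hx.diag]
    rcases hy with hy | ⟨rfl, rfl⟩ <;> rcases hz with hz | ⟨rfl, rfl⟩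
    · rw [h1]
      exact Or.inl (lie_mem_coveredPart hy hz)
    · rw [h1, h2, ← lie_skew, add_comm β, add_comm _ (2 : ℤ)]
      exact Or.inl (neg_mem (gen_lie_mem_coveredPart hy))
    · rw [h1, h2]
      exact Or.inl (gen_lie_mem_coveredPart hz)
    · rw [lie_self]
      exact Or.inl (zero_mem _)

/-- If the weight `k` of the multidegree `β` at `r` is nonnegative, then the elements of multidegree
`β` are obtained from those of the reflected multidegree `β - k α_r`, unless `β = α_r`. -/
lemma gradedPart_le_map [CharZero K] (hx : SerreRelations K A x) (r : I) {β : I → ℤ} {k : ℕ}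
    (hk : A.mulVec β r = k) (hβ : β ≠ Pi.single r 1) :
    gradedPart K x β ≤
      (gradedPart K x (β - (k : ℤ) • Pi.single r 1)).map ((ad K L (x r)) ^ k) := by
  have h : coveredPart K x r β k ≤
      (gradedPart K x (β - (k : ℤ) • Pi.single r 1)).map ((ad K L (x r)) ^ k) := by
    rw [coveredPart, Submodule.span_le]
    rintro _ ⟨S, w, hw, rfl⟩
    exact S.exists_lie_pow_eq hw
  refine le_trans (Submodule.span_le.2 fun z hz => ?_) h
  have := (hx.mem_coveredPart r hz).resolve_right fun h => hβ h.1
  rwa [hk] at this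

end SerreRelations

end Graded

/-! ### Serre relations bound the root multiplicities -/

section RootMultiplicities

universe u

variable {ι M N L : Type*} {K : Type u} [Field K]
  [AddCommGroup M] [Module K M] [AddCommGroup N] [Module K N]
  {P : RootPairing ι K M N} [P.IsCrystallographic]
  [LieRing L] [LieAlgebra K L]

lemma toLinearMap_sum_coroot (b : P.Base) (β : b.support → ℤ) (r : b.support) :
    P.toLinearMap (∑ s, β s • P.root s) (P.coroot r) =
      ((∑ s, β s * b.cartanMatrix s r : ℤ) : K) := by
  have h (s : b.support) : ((b.cartanMatrix s r : ℤ) : K) = P.pairing s r :=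
    b.algebraMap_cartanMatrixIn_apply ℤ s r
  simp [h]

variable [CharZero K] [Finite ι] [P.IsRootSystem]

/-- Positive definiteness of the form `(u, v) = ∑ i, ⟨u, α_i^∨⟩ ⟨v, α_i^∨⟩`: if `v = ∑ β_s α_s`
paired nonpositively with all simple coroots, then `(v, v) ≤ 0` and so `v = 0`. The computation uses
the integers `p i = ⟨v, α_i^∨⟩`, since `K` carries no order. -/
lemma exists_cartanMatrix_sum_pos (b : P.Base) {β : b.support → ℤ} (hβ : 0 ≤ β) (hβ0 : β ≠ 0) :
    ∃ r, 0 < ∑ s, β s * b.cartanMatrix s r := by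
  have := Fintype.ofFinite ι
  by_contra! hneg
  set v : M := ∑ s, β s • P.root s with hv
  let p (i : ι) : ℤ := ∑ s, β s * P.pairingIn ℤ s i
  have hp (i : ι) : ((p i : ℤ) : K) = P.toLinearMap v (P.coroot i) := by
    have h (s : b.support) : ((P.pairingIn ℤ s i : ℤ) : K) = P.pairing s i :=
      P.algebraMap_pairingIn ℤ s i
    simp [p, hv, h]
  -- This is `2 (α_s, v) = (α_s, α_s) ⟨v, α_s^∨⟩`, so `(α_s, v)` is nonpositive together with `p s`.
  have hq (s : b.support) : 2 * ∑ i, P.pairingIn ℤ s i * p i =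
      (∑ i, P.pairingIn ℤ s i * P.pairingIn ℤ s i) * p s := by
    have h1 := congrArg (P.toLinearMap v) (P.rootForm_self_smul_coroot (s : ι))
    rw [map_smul, map_nsmul, P.toLinearMap_apply_apply_Polarization, P.rootForm_root_self,
      P.rootForm_apply_apply, ← hp] at h1
    have h (i : ι) : ((P.pairingIn ℤ s i : ℤ) : K) = P.pairing s i :=
      P.algebraMap_pairingIn ℤ s i
    have h2 (i : ι) : P.coroot' i v = (p i : K) := (hp i).symm
    simp only [h2, RootPairing.root_coroot'_eq_pairing, ← h] at h1
    rw [smul_eq_mul, nsmul_eq_mul] at h1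
    exact_mod_cast h1.symm
  have hsum : 2 * ∑ i, p i * p i ≤ 0 := by
    have h1 : ∑ i, p i * p i = ∑ s : b.support, β s * ∑ i, P.pairingIn ℤ s i * p i := by
      simp only [Finset.mul_sum]
      rw [Finset.sum_comm]
      refine Finset.sum_congr rfl fun i _ => ?_
      simp only [← mul_assoc, ← Finset.sum_mul]
      rfl
    rw [h1, Finset.mul_sum]
    refine Finset.sum_nonpos fun s _ => ?_
    rw [mul_left_comm, hq]
    refine mul_nonpos_of_nonneg_of_nonpos (hβ s) (mul_nonpos_of_nonneg_of_nonpos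
      (Finset.sum_nonneg fun i _ => mul_self_nonneg _) (hneg s))
  have hp0 (i : ι) : p i = 0 := by
    have h1 : 0 ≤ ∑ i, p i * p i := Finset.sum_nonneg fun i _ => mul_self_nonneg _
    have h2 := (Finset.sum_eq_zero_iff_of_nonneg fun i _ => mul_self_nonneg (p i)).1
      (by omega : ∑ i, p i * p i = 0) i (Finset.mem_univ i)
    exact mul_self_eq_zero.1 h2
  have hv0 : v = 0 := by
    apply P.toPerfPair.injective
    rw [map_zero]
    refine b.toCoweightBasis.ext fun r => ?_
    rw [b.toCoweightBasis_apply]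
    refine (hp r).symm.trans ?_
    simp [hp0]
  refine hβ0 (funext fun s => ?_)
  exact Fintype.linearIndependent_iff.1 (b.linearIndepOn_root.restrict_scalars' ℤ) β
    (hv.symm.trans hv0) s

/-- Induction on the sum of the coefficients. Reflecting in an `r` where `β` has positive weight
lowers the sum, and both claims pass back through `ad(x_r)^k`. If the reflected degree leaves the
positive cone, it contains no brackets, so degree `β` vanishes too; this covers proper multiples of
`α_r`. -/
lemma gradedPart_root_multiplicity (b : P.Base) [DecidableEq b.support] {x : b.support → L}
    (hx : SerreRelations K (fun r s => b.cartanMatrix s r) x) (β : b.support → ℤ) :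
    (∃ y, gradedPart K x β ≤ Submodule.span K {y}) ∧
      ((∀ i, P.root i ≠ ∑ s, β s • P.root s) → gradedPart K x β = ⊥) := by
  generalize hn : (∑ s, β s).toNat = n
  induction n using Nat.strong_induction_on generalizing β with
  | _ n ih =>
  by_cases hβ : ∃ z, IsMonomial x β z
  swap
  · have : gradedPart K x β = ⊥ := by
      exact Submodule.span_eq_bot.2 fun z hz => (hβ ⟨z, hz⟩).elim
    exact ⟨⟨0, by simp [this]⟩, fun _ => this⟩
  obtain ⟨z, hz⟩ := hβ
  have hpos := hz.nonneg
  have hone := hz.one_le_sum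
  by_cases hsum : ∑ s, β s = 1
  · obtain ⟨r, rfl, rfl⟩ := hz.eq_gen hsum
    refine ⟨⟨x r, Submodule.span_le.2 fun y hy => ?_⟩, fun h => ?_⟩
    · obtain ⟨s, hs, rfl⟩ := IsMonomial.eq_gen hy hsum
      have hrs : r = s := by
        by_contra hrs
        have := congrFun hs r
        simp [hrs] at this
      rw [hrs]
      exact Submodule.mem_span_singleton_self _
    · refine absurd ?_ (h r)
      simp [Pi.single_apply, Finset.sum_ite_eq']
  obtain ⟨r, hr⟩ := exists_cartanMatrix_sum_pos b hpos (by rintro rfl; simp at hone)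
  obtain ⟨k, hk⟩ := Int.eq_ofNat_of_zero_le hr.le
  have hk' : Matrix.mulVec (fun r s => b.cartanMatrix s r) β r = k := by
    rw [← hk]
    simp [Matrix.mulVec, dotProduct, mul_comm]
  have hle := hx.gradedPart_le_map r hk' (by rintro rfl; simp at hsum)
  set γ := β - (k : ℤ) • Pi.single r 1 with hγ
  have hγsum : ∑ s, γ s = ∑ s, β s - k := by
    simp [hγ, Finset.sum_sub_distrib, ← Finset.mul_sum]
  -- The new sum may be negative, but `toNat` still drops strictly, because `∑ β ≥ 1` and `k > 0`.
  obtain ⟨⟨y, hy⟩, h0⟩ := ih _ (by omega) γ rfl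
  refine ⟨⟨((ad K L (x r)) ^ k) y, hle.trans ?_⟩, fun h => ?_⟩
  · refine (Submodule.map_mono hy).trans ?_
    rw [Submodule.map_span, Set.image_singleton]
  · rw [eq_bot_iff]
    refine hle.trans ?_
    rw [h0, Submodule.map_bot]
    intro i hi
    refine h (P.reflectionPerm r i) ?_
    have h1 : ∑ s, γ s • P.root s = P.reflection r (∑ s, β s • P.root s) := by
      have h2 := toLinearMap_sum_coroot b β r
      rw [P.reflection_apply]
      change _ = _ - (P.toLinearMap _ (P.coroot r)) • _
      rw [h2, hk]
      simp [hγ, sub_smul, Finset.sum_sub_distrib, Pi.single_apply, ite_smul,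
        Nat.cast_smul_eq_nsmul]
    rw [P.root_reflectionPerm, hi, h1, P.reflection_same]

end RootMultiplicities

/-! ### Spans of iterated brackets -/

section Monomials

variable {I K L : Type*} [DecidableEq I] [Field K] [LieRing L] [LieAlgebra K L] {x h : I → L}

/-- The iterated brackets of the elements `x r`, of any multidegree. -/
def monomials (x : I → L) : Set L := {y | ∃ β, IsMonomial x β y}

lemma IsMonomial.lie_eq_smul {u : L} (hu : ∀ s, ∃ c : K, ⁅u, x s⁆ = c • x s) {β : I → ℤ} {y : L}
    (hy : IsMonomial x β y) : ∃ c : K, ⁅u, y⁆ = c • y := by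
  induction hy with
  | gen r => exact hu r
  | lie _ _ h1 h2 =>
    obtain ⟨c, hc⟩ := h1
    obtain ⟨d, hd⟩ := h2
    exact ⟨c + d, by rw [leibniz_lie, hc, hd, smul_lie, lie_smul, add_smul]⟩

/-- Used with `u` a generator of the opposite sign: Leibniz reduces to brackets with single
generators, which give combinations of the `h r`, and these act on brackets by scalars. -/
lemma IsMonomial.lie_mem_span_union (hh : ∀ r s, ∃ c : K, ⁅h r, x s⁆ = c • x s) {u : L}
    (hu : ∀ s, ⁅u, x s⁆ ∈ Submodule.span K (Set.range h)) {β : I → ℤ} {y : L}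
    (hy : IsMonomial x β y) : ⁅u, y⁆ ∈ Submodule.span K (Set.range h ∪ monomials x) := by
  have key {v z : L} (hv : v ∈ Submodule.span K (Set.range h ∪ monomials x))
      (hz : z ∈ monomials x) : ⁅v, z⁆ ∈ Submodule.span K (Set.range h ∪ monomials x) := by
    refine lie_mem_span ?_ hv (Submodule.subset_span hz)
    rintro _ (⟨r, rfl⟩ | ⟨β, hβ⟩) z ⟨γ, hγ⟩
    · obtain ⟨c, hc⟩ := hγ.lie_eq_smul (hh r)
      rw [hc]
      exact Submodule.smul_mem _ _ (Submodule.subset_span (Or.inr ⟨γ, hγ⟩))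
    · exact Submodule.subset_span (Or.inr ⟨β + γ, hβ.lie hγ⟩)
  induction hy with
  | gen r => exact Submodule.span_mono Set.subset_union_left (hu r)
  | lie hy hz h1 h2 =>
    rw [leibniz_lie]
    refine add_mem (key h1 ⟨_, hz⟩) ?_
    rw [← lie_skew]
    exact neg_mem (key h2 ⟨_, hy⟩)

/-- The elements whose bracket preserves `T` form a Lie subalgebra, so it is enough to test
generators. -/
lemma eq_top_of_lieSpan_eq_top {s : Set L} (hs : LieSubalgebra.lieSpan K L s = ⊤)
    {T : Submodule K L} (hsT : s ⊆ T) (hT : ∀ u ∈ s, ∀ y ∈ T, ⁅u, y⁆ ∈ T) : T = ⊤ := by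
  have h1 (u : L) : ∀ y ∈ T, ⁅u, y⁆ ∈ T := by
    have hu : u ∈ LieSubalgebra.lieSpan K L s := hs ▸ LieSubalgebra.mem_top u
    induction hu using LieSubalgebra.lieSpan_induction with
    | mem u hu => exact hT u hu
    | zero => simp
    | add u v _ _ hu hv => intro y hy; rw [add_lie]; exact add_mem (hu y hy) (hv y hy)
    | smul c u _ hu => intro y hy; rw [smul_lie]; exact T.smul_mem c (hu y hy)
    | lie u v _ _ hu hv =>
      intro y hy
      rw [lie_lie]
      exact sub_mem (hu _ (hv y hy)) (hv _ (hu y hy))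
  rw [eq_top_iff]
  intro u _
  have hu : u ∈ LieSubalgebra.lieSpan K L s := hs ▸ LieSubalgebra.mem_top u
  induction hu using LieSubalgebra.lieSpan_induction with
  | mem u hu => exact hsT hu
  | zero => exact zero_mem _
  | add u v _ _ hu hv => exact add_mem (hu trivial) (hv trivial)
  | smul c u _ hu => exact T.smul_mem c (hu trivial)
  | lie u v _ _ _ hv => exact h1 u v (hv trivial)

end Monomials

/-! ### The presented algebra: relations, universal property, triangular spanning set -/

namespace GTilde

section Relations

variable {I : Type*} (a : Matrix I I ℤ) (ε : I → ℝ)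

lemma lie_H_H (r s : I) : ⁅H a ε r, H a ε s⁆ = 0 := by
  simpa [H] using proj_relator a ε (Relator.HH r s)

lemma lie_H_Xp (r s : I) : ⁅H a ε r, Xp a ε s⁆ = (a r s : ℂ) • Xp a ε s := by
  have h := proj_relator a ε (Relator.Tp r s)
  rwa [map_sub, LieHom.map_lie, _root_.map_smul, sub_eq_zero] at h

lemma lie_H_Xm (r s : I) : ⁅H a ε r, Xm a ε s⁆ = (-a r s : ℂ) • Xm a ε s := by
  have h := proj_relator a ε (Relator.Tm r s)
  rwa [_root_.map_add, LieHom.map_lie, _root_.map_smul, add_eq_zero_iff_eq_neg, ← neg_smul] at h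

lemma serre_Xp {r s : I} (h : r ≠ s) :
    ((ad ℂ (GTilde a ε) (Xp a ε r)) ^ (1 - a r s).toNat) (Xp a ε s) = 0 := by
  have := proj_relator a ε (Relator.Sp r s h)
  rwa [map_ad_pow] at this

lemma serre_Xm {r s : I} (h : r ≠ s) :
    ((ad ℂ (GTilde a ε) (Xm a ε r)) ^ (1 - a r s).toNat) (Xm a ε s) = 0 := by
  have := proj_relator a ε (Relator.Sm r s h)
  rwa [map_ad_pow] at this

lemma lie_Xp_Xm_self (r : I) : ⁅Xp a ε r, Xm a ε r⁆ = (ε r : ℂ) • H a ε r := by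
  have h := proj_relator a ε (Relator.Cs r)
  rwa [map_sub, LieHom.map_lie, _root_.map_smul, sub_eq_zero] at h

lemma lie_Xp_Xm_of_ne {r s : I} (h : r ≠ s) : ⁅Xp a ε r, Xm a ε s⁆ = 0 := by
  have := proj_relator a ε (Relator.Cn r s h)
  rwa [LieHom.map_lie] at this

lemma lieSpan_eq_top : LieSubalgebra.lieSpan ℂ (GTilde a ε)
    (Set.range (H a ε) ∪ (Set.range (Xp a ε) ∪ Set.range (Xm a ε))) = ⊤ := by
  set S := LieSubalgebra.lieSpan ℂ (GTilde a ε)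
    (Set.range (H a ε) ∪ (Set.range (Xp a ε) ∪ Set.range (Xm a ε)))
  have hp (r : I) : Xp a ε r ∈ S := LieSubalgebra.subset_lieSpan (by simp)
  have hm (r : I) : Xm a ε r ∈ S := LieSubalgebra.subset_lieSpan (by simp)
  have hH (r : I) : H a ε r ∈ S := LieSubalgebra.subset_lieSpan (by simp)
  let F : FreeLieAlgebra ℂ (Gen I) →ₗ⁅ℂ⁆ S := FreeLieAlgebra.lift ℂ fun
    | .Xp r => ⟨_, hp r⟩
    | .Xm r => ⟨_, hm r⟩
    | .H r => ⟨_, hH r⟩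
  have hF : S.incl.comp F = proj a ε := by
    apply FreeLieAlgebra.hom_ext
    rintro (r | r | r) <;> simp [F] <;> rfl
  rw [eq_top_iff]
  intro x _
  obtain ⟨x, rfl⟩ := proj_surjective a ε x
  rw [← hF]
  exact (F x).2

/-- A Lie algebra with elements satisfying the defining relations receives a homomorphism from
the presented Lie algebra. -/
lemma exists_lift {L : Type*} [LieRing L] [LieAlgebra ℂ L] (x y h : I → L)
    (hh : ∀ r s, ⁅h r, h s⁆ = 0)
    (hx : ∀ r s, ⁅h r, x s⁆ = (a r s : ℂ) • x s)
    (hy : ∀ r s, ⁅h r, y s⁆ = (-a r s : ℂ) • y s)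
    (sx : ∀ r s, r ≠ s → ((ad ℂ L (x r)) ^ (1 - a r s).toNat) (x s) = 0)
    (sy : ∀ r s, r ≠ s → ((ad ℂ L (y r)) ^ (1 - a r s).toNat) (y s) = 0)
    (hxy : ∀ r, ⁅x r, y r⁆ = (ε r : ℂ) • h r)
    (hne : ∀ r s, r ≠ s → ⁅x r, y s⁆ = 0) :
    ∃ F : GTilde a ε →ₗ⁅ℂ⁆ L,
      (∀ r, F (Xp a ε r) = x r) ∧ (∀ r, F (Xm a ε r) = y r) ∧ ∀ r, F (H a ε r) = h r := by
  let F : FreeLieAlgebra ℂ (Gen I) →ₗ⁅ℂ⁆ L := FreeLieAlgebra.lift ℂ fun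
    | .Xp r => x r
    | .Xm r => y r
    | .H r => h r
  have Fx (r : I) : F (xp r) = x r := by simp [F, xp]
  have Fy (r : I) : F (xm r) = y r := by simp [F, xm]
  have Fh (r : I) : F (EpsLie.hh r) = h r := by simp [F, EpsLie.hh]
  have hF : ∀ z, Relator a ε z → F z = 0 := by
    intro z hz
    cases hz with
    | HH r s => simp [Fh, hh]
    | Tp r s => simp [Fh, Fx, hx]
    | Tm r s => simp [Fh, Fy, hy]
    | Sp r s hrs => rw [map_ad_pow, Fx, Fx, sx r s hrs]
    | Sm r s hrs => rw [map_ad_pow, Fy, Fy, sy r s hrs]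
    | Cs r => rw [map_sub, LieHom.map_lie, _root_.map_smul, Fx, Fy, Fh, hxy, sub_self]
    | Cn r s hrs => simp [Fx, Fy, hne r s hrs]
  let G : GTilde a ε →ₗ[ℂ] L :=
    (relIdeal a ε).toSubmodule.liftQ F.toLinearMap fun z hz => lift_aux F hF z hz
  have hG (z) : G (proj a ε z) = F z := rfl
  refine ⟨{ G with map_lie' := ?_ }, Fx, Fy, Fh⟩
  intro u v
  obtain ⟨u, rfl⟩ := proj_surjective a ε u
  obtain ⟨v, rfl⟩ := proj_surjective a ε v
  change G _ = ⁅G _, G _⁆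
  rw [← LieHom.map_lie, hG, hG, hG, LieHom.map_lie]

variable [DecidableEq I]

lemma span_monomials_eq_top : Submodule.span ℂ
    (Set.range (H a ε) ∪ (monomials (Xp a ε) ∪ monomials (Xm a ε))) = ⊤ := by
  have hp (r s : I) : ∃ c : ℂ, ⁅H a ε r, Xp a ε s⁆ = c • Xp a ε s := ⟨_, lie_H_Xp a ε r s⟩
  have hm (r s : I) : ∃ c : ℂ, ⁅H a ε r, Xm a ε s⁆ = c • Xm a ε s := ⟨_, lie_H_Xm a ε r s⟩
  have hpm (r s : I) : ⁅Xp a ε r, Xm a ε s⁆ ∈ Submodule.span ℂ (Set.range (H a ε)) := by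
    rcases eq_or_ne r s with rfl | h
    · rw [lie_Xp_Xm_self]
      exact Submodule.smul_mem _ _ (Submodule.subset_span ⟨r, rfl⟩)
    · rw [lie_Xp_Xm_of_ne a ε h]
      exact zero_mem _
  have hmp (r s : I) : ⁅Xm a ε r, Xp a ε s⁆ ∈ Submodule.span ℂ (Set.range (H a ε)) := by
    rw [← lie_skew]
    exact neg_mem (hpm s r)
  set T := Submodule.span ℂ (Set.range (H a ε) ∪ (monomials (Xp a ε) ∪ monomials (Xm a ε)))
    with hT
  have hTp : Submodule.span ℂ (Set.range (H a ε) ∪ monomials (Xp a ε)) ≤ T :=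
    Submodule.span_mono (Set.union_subset_union_right _ Set.subset_union_left)
  have hTm : Submodule.span ℂ (Set.range (H a ε) ∪ monomials (Xm a ε)) ≤ T :=
    Submodule.span_mono (Set.union_subset_union_right _ Set.subset_union_right)
  have mp {β y} (hy : IsMonomial (Xp a ε) β y) : y ∈ T :=
    hTp (Submodule.subset_span (Or.inr ⟨β, hy⟩))
  have mm {β y} (hy : IsMonomial (Xm a ε) β y) : y ∈ T :=
    hTm (Submodule.subset_span (Or.inr ⟨β, hy⟩))
  refine eq_top_of_lieSpan_eq_top (lieSpan_eq_top a ε) ?_ ?_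
  · rintro _ (⟨r, rfl⟩ | ⟨r, rfl⟩ | ⟨r, rfl⟩)
    · exact Submodule.subset_span (Or.inl ⟨r, rfl⟩)
    · exact mp (.gen r)
    · exact mm (.gen r)
  · intro u hu y hy
    refine lie_mem_span ?_ (Submodule.mem_span_singleton_self (R := ℂ) u) hy
    rintro _ rfl z hz
    rw [← hT]
    rcases hu with ⟨r, rfl⟩ | ⟨r, rfl⟩ | ⟨r, rfl⟩ <;>
      rcases hz with ⟨s, rfl⟩ | ⟨β, hβ⟩ | ⟨β, hβ⟩
    · rw [lie_H_H]
      exact zero_mem _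
    · obtain ⟨c, hc⟩ := hβ.lie_eq_smul (hp r)
      rw [hc]
      exact T.smul_mem c (mp hβ)
    · obtain ⟨c, hc⟩ := hβ.lie_eq_smul (hm r)
      rw [hc]
      exact T.smul_mem c (mm hβ)
    · rw [← lie_skew, lie_H_Xp]
      exact neg_mem (T.smul_mem _ (mp (.gen r)))
    · exact mp (.lie (.gen r) hβ)
    · exact hTm (hβ.lie_mem_span_union hm (hpm r))
    · rw [← lie_skew, lie_H_Xm]
      exact neg_mem (T.smul_mem _ (mm (.gen r)))
    · exact hTp (hβ.lie_mem_span_union hp (hmp r))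
    · exact mm (.lie (.gen r) hβ)

end Relations

/-! ### Upper bound for the dimension of the presented algebra -/

section Finrank

variable {ι M N : Type*} [Finite ι] [AddCommGroup M] [Module ℂ M] [AddCommGroup N] [Module ℂ N]
  {P : RootPairing ι ℂ M N} [P.IsCrystallographic]

lemma serreRelations_of_cartanMatrix (b : P.Base) {L : Type*} [LieRing L] [LieAlgebra ℂ L]
    [DecidableEq b.support] {x : b.support → L}
    (hx : ∀ r s, r ≠ s → ((ad ℂ L (x r)) ^ (1 - b.cartanMatrix s r).toNat) (x s) = 0) :
    SerreRelations ℂ (fun r s => b.cartanMatrix s r) x where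
  diag r := by simp
  nonpos r s h := b.cartanMatrix_le_zero_of_ne s r h.symm
  serre := hx

variable [P.IsRootSystem]

/-- The presented Lie algebra is spanned by as many elements as there are simple roots and roots. -/
lemma exists_span_range_eq_top (b : P.Base) (ε : b.support → ℝ) :
    ∃ v : b.support ⊕ ι → GTilde (fun r s => b.cartanMatrix s r) ε,
      Submodule.span ℂ (Set.range v) = ⊤ := by
  classical
  set a : Matrix b.support b.support ℤ := fun r s => b.cartanMatrix s r
  have hp := gradedPart_root_multiplicity b (serreRelations_of_cartanMatrix b (x := Xp a ε)
    fun r s h => serre_Xp a ε h)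
  have hm := gradedPart_root_multiplicity b (serreRelations_of_cartanMatrix b (x := Xm a ε)
    fun r s h => serre_Xm a ε h)
  choose yp hyp using fun β => (hp β).1
  choose ym hym using fun β => (hm β).1
  -- An arbitrary choice of integer coefficients suffices: only roots equal to a given integral
  -- combination matter, and for those linear independence of the simple roots forces the choice.
  let coeff (i : ι) : b.support → ℤ :=
    Classical.epsilon fun β => P.root i = ∑ s, β s • P.root s
  have hcoeff {i : ι} {β : b.support → ℤ} (h : P.root i = ∑ s, β s • P.root s) :
      coeff i = β := by
    have h1 : P.root i = ∑ s, coeff i s • P.root s :=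
      Classical.epsilon_spec (p := fun β : b.support → ℤ => P.root i = ∑ s, β s • P.root s) ⟨β, h⟩
    exact funext (Fintype.linearIndependent_iffₛ.1
      (b.linearIndepOn_root.restrict_scalars' ℤ) _ _ (h1.symm.trans h))
  let v : b.support ⊕ ι → GTilde a ε := Sum.elim (H a ε) fun i =>
    if 0 ≤ coeff i then yp (coeff i) else ym (-coeff i)
  refine ⟨v, ?_⟩
  rw [eq_top_iff, ← span_monomials_eq_top a ε, Submodule.span_le]
  have hv (i : ι) : Submodule.span ℂ {v (.inr i)} ≤ Submodule.span ℂ (Set.range v) :=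
    Submodule.span_mono (Set.singleton_subset_iff.2 ⟨_, rfl⟩)
  rintro y (⟨r, rfl⟩ | ⟨β, hβ⟩ | ⟨β, hβ⟩)
  · exact Submodule.subset_span ⟨.inl r, rfl⟩
  · have hy : y ∈ gradedPart ℂ (Xp a ε) β := Submodule.subset_span hβ
    by_cases h : ∀ i, P.root i ≠ ∑ s, β s • P.root s
    · rw [(hp β).2 h, Submodule.mem_bot] at hy
      rw [hy]
      exact zero_mem _
    · push Not at h
      obtain ⟨i, hi⟩ := h
      apply hv i
      simp only [v, Sum.elim_inr]
      rw [hcoeff hi, if_pos hβ.nonneg]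
      exact hyp β hy
  · have hy : y ∈ gradedPart ℂ (Xm a ε) β := Submodule.subset_span hβ
    by_cases h : ∀ i, P.root i ≠ ∑ s, β s • P.root s
    · rw [(hm β).2 h, Submodule.mem_bot] at hy
      rw [hy]
      exact zero_mem _
    · push Not at h
      obtain ⟨i, hi⟩ := h
      -- A bracket of the `X_r⁻` of multidegree `β` belongs to the root `-β`, whose index is
      -- `reflectionPerm i i`.
      have hj : P.root (P.reflectionPerm i i) = ∑ s, (-β) s • P.root s := by
        rw [P.root_reflectionPerm, P.reflection_apply_self, hi]
        simp
      apply hv (P.reflectionPerm i i)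
      simp only [v, Sum.elim_inr]
      rw [hcoeff hj, if_neg, neg_neg]
      · exact hym β hy
      · intro hneg
        have h1 := hβ.one_le_sum
        have h2 : ∑ s, β s ≤ 0 := Finset.sum_nonpos fun s _ => neg_nonneg.1 (hneg s)
        omega

lemma finite_and_finrank_le [Fintype ι] (b : P.Base) (ε : b.support → ℝ) :
    Module.Finite ℂ (GTilde (fun r s => b.cartanMatrix s r) ε) ∧
      Module.finrank ℂ (GTilde (fun r s => b.cartanMatrix s r) ε) ≤
        Fintype.card (b.support ⊕ ι) := by
  obtain ⟨v, hv⟩ := exists_span_range_eq_top b ε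
  constructor
  · exact Module.finite_def.2 (hv ▸ Submodule.fg_span (Set.finite_range v))
  · rw [← finrank_top, ← hv]
    exact finrank_range_le_card v

end Finrank

end GTilde

/-! ### Powers of `ad`, under involutions and on root spaces -/

section AdPow

variable {𝔤 : Type*} [LieRing 𝔤] [LieAlgebra ℂ 𝔤]

lemma LieInvolution.map_ad_pow (d : LieInvolution 𝔤) (x y : 𝔤) (n : ℕ) :
    d (((ad ℂ 𝔤 x) ^ n) y) = (-1 : ℂ) ^ n • ((ad ℂ 𝔤 (d x)) ^ n) (d y) := by
  induction n with
  | zero => simp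
  | succ n ih =>
    rw [pow_succ', pow_succ', pow_succ', Module.End.mul_apply, Module.End.mul_apply, ad_apply,
      ad_apply, d.map_lie, ih, ← lie_skew, lie_smul, mul_smul, neg_one_smul]

lemma ad_smul_pow_smul (c d : ℂ) (x y : 𝔤) (n : ℕ) :
    ((ad ℂ 𝔤 (c • x)) ^ n) (d • y) = (c ^ n * d) • ((ad ℂ 𝔤 x) ^ n) y := by
  rw [_root_.map_smul, _root_.map_smul, smul_pow, LinearMap.smul_apply, smul_smul, mul_comm]

lemma ad_pow_mem_rootSpace {𝔥 : LieSubalgebra ℂ 𝔤} [𝔥.IsCartanSubalgebra]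
    {φ ψ : Module.Dual ℂ 𝔥} {y z : 𝔤} (hy : y ∈ rootSpace 𝔥 φ)
    (hz : z ∈ rootSpace 𝔥 ψ) (n : ℕ) :
    ((ad ℂ 𝔤 y) ^ n) z ∈ rootSpace 𝔥 (ψ + n • φ : Module.Dual ℂ 𝔥) := by
  induction n with
  | zero => simpa using hz
  | succ n ih =>
    rw [pow_succ', Module.End.mul_apply, ad_apply]
    have : (ψ + (n + 1) • φ : Module.Dual ℂ 𝔥) = φ + (ψ + n • φ) := by module
    rw [this]
    exact lie_mem_genWeightSpace_of_mem_genWeightSpace hy ih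

end AdPow

/-! ### The contracted algebra: parametrization and dimension -/

section Contraction

variable {𝔤 : Type*} [LieRing 𝔤] [LieAlgebra ℂ 𝔤] [FiniteDimensional ℂ 𝔤] [IsKilling ℂ 𝔤]
  {𝔥 : LieSubalgebra ℂ 𝔤} [𝔥.IsCartanSubalgebra] {b : (rootSystem 𝔥).Base}

lemma weightScale_apply_of_mem (c : Module.Dual ℂ 𝔥 → ℝ) (φ : Module.Dual ℂ 𝔥) {z : 𝔤}
    (hz : z ∈ rootSpace 𝔥 φ) :
    weightScale (𝔥 := 𝔥) (fun χ => c χ.toLinear) z = (c φ : ℂ) • z := by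
  by_cases h0 : z = 0
  · simp [h0]
  let γ : Weight ℂ 𝔥 𝔤 := ⟨φ, fun h => h0 (by simpa [h] using hz)⟩
  have hγ : γ.toLinear = φ := by ext; simp [γ]
  have := weightScale_apply (fun χ : Weight ℂ 𝔥 𝔤 => c χ.toLinear) γ hz
  rwa [hγ] at this

lemma SPlus_apply_of_mem (ε : RealChar b) (φ : Module.Dual ℂ 𝔥) {z : 𝔤}
    (hz : z ∈ rootSpace 𝔥 φ) : SPlus ε z = (ε.ext φ : ℂ) • z :=
  weightScale_apply_of_mem ε.ext φ hz

lemma SMinus_apply_of_mem (ε : RealChar b) (φ : Module.Dual ℂ 𝔥) {z : 𝔤}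
    (hz : z ∈ rootSpace 𝔥 φ) : SMinus ε z = (ε.ext (-φ) : ℂ) • z :=
  weightScale_apply_of_mem (fun ψ => ε.ext (-ψ)) φ hz

/-- The linear parametrization `z ↦ (S_ε⁺ z, S_ε⁻ z)` of `𝔤_ε`. -/
def toGEps (ε : RealChar b) : 𝔤 →ₗ[ℂ] gEps ε :=
  ((SPlus ε).prod (SMinus ε)).codRestrict (gEps ε).toSubmodule fun z => ⟨z, rfl⟩

lemma coe_toGEps (ε : RealChar b) (z : 𝔤) :
    (toGEps ε z : 𝔤 × 𝔤) = (SPlus ε z, SMinus ε z) := rfl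

lemma toGEps_surjective (ε : RealChar b) : Function.Surjective (toGEps ε) := by
  rintro ⟨_, z, rfl⟩
  exact ⟨z, rfl⟩

lemma toGEps_injective (ε : RealChar b) : Function.Injective (toGEps ε) := by
  classical
  -- On each weight space at least one of `S⁺`, `S⁻` is the identity. The indicators `c` and `c'`
  -- select such a coordinate, which gives a left inverse.
  let c (φ : Module.Dual ℂ 𝔥) : ℝ := if ε.ext φ = 1 then 1 else 0
  let c' (φ : Module.Dual ℂ 𝔥) : ℝ := if ε.ext φ = 1 then 0 else 1
  have key (z : 𝔤) : weightScale (𝔥 := 𝔥) (fun χ => c χ.toLinear) (SPlus ε z) +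
      weightScale (𝔥 := 𝔥) (fun χ => c' χ.toLinear) (SMinus ε z) = z := by
    induction z using weight_induction 𝔥 with
    | zero => simp
    | add x y hx hy =>
      simp only [_root_.map_add]
      nth_rw 3 [← hx]
      nth_rw 3 [← hy]
      abel
    | mem χ z hz =>
      rw [SPlus, SMinus, weightScale_apply _ χ hz, weightScale_apply _ χ hz, _root_.map_smul,
        _root_.map_smul, weightScale_apply _ χ hz, weightScale_apply _ χ hz]
      by_cases h : ε.ext χ.toLinear = 1
      · simp [c, c', h]
      · have h1 : ε.ext (-χ.toLinear) = 1 := by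
          rcases weight_cases b χ with h2 | h2
          · exact ε.ext_of_neg_mem (by simpa using h2)
          · exact absurd (ε.ext_of_neg_mem h2) h
        simp [c, c', h, h1]
  rw [← LinearMap.ker_eq_bot, LinearMap.ker_eq_bot']
  intro z hz
  have h := congrArg Subtype.val hz
  rw [coe_toGEps] at h
  have h1 : SPlus ε z = 0 := congrArg Prod.fst h
  have h2 : SMinus ε z = 0 := congrArg Prod.snd h
  rw [← key z, h1, h2, _root_.map_zero, _root_.map_zero, add_zero]

lemma card_add_card_le_finrank (b : (rootSystem 𝔥).Base) :
    Fintype.card (b.support ⊕ 𝔥.root) ≤ Module.finrank ℂ 𝔤 := by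
  classical
  have h1 : Module.finrank ℂ 𝔥 = Fintype.card b.support :=
    Module.finrank_eq_card_basis b.toCoweightBasis
  have h2 : Module.finrank ℂ 𝔤 = ∑ χ : Weight ℂ 𝔥 𝔤, Module.finrank ℂ (rootSpace 𝔥 χ) := by
    rw [← (LinearEquiv.ofBijective _ (isInternal 𝔥)).finrank_eq]
    exact Module.finrank_directSum _ _
  have h3 : ∑ χ ∈ 𝔥.root, Module.finrank ℂ (rootSpace 𝔥 χ) = Fintype.card 𝔥.root := by
    rw [Finset.sum_congr rfl fun χ hχ => finrank_rootSpace_eq_one χ (by simpa using hχ)]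
    rw [Finset.sum_const, smul_eq_mul, mul_one, Fintype.card_coe]
  rw [h2, ← Finset.sum_add_sum_compl 𝔥.root, h3, Fintype.card_sum, add_comm]
  refine Nat.add_le_add_left ?_ _
  -- The zero functional counts as a weight only if its weight space `𝔥` is nonzero. If `𝔥 = 0`
  -- there are no simple roots to account for.
  rcases subsingleton_or_nontrivial 𝔥 with h | h
  · rw [← h1, Module.finrank_zero_of_subsingleton]
    exact Nat.zero_le _
  · have h4 : Module.finrank ℂ (rootSpace 𝔥 (0 : Weight ℂ 𝔥 𝔤)) = Fintype.card b.support := by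
      rw [← h1, FunLike.coe_zero, rootSpace_zero_eq]
      rfl
    rw [← h4]
    exact Finset.single_le_sum
      (f := fun χ : Weight ℂ 𝔥 𝔤 => Module.finrank ℂ (rootSpace 𝔥 χ))
      (fun _ _ => Nat.zero_le _) (by simp [Weight.IsZero])

lemma lie_toGEps (ε : RealChar b) {φ ψ : Module.Dual ℂ 𝔥} (hφ : φ ∈ QPlus b) (hψ : ψ ∈ QPlus b)
    {y z : 𝔤} (hy : y ∈ rootSpace 𝔥 φ) (hz : z ∈ rootSpace 𝔥 ψ) :
    ⁅toGEps ε y, toGEps ε z⁆ = toGEps ε ⁅y, z⁆ := by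
  have hyz : ⁅y, z⁆ ∈ rootSpace 𝔥 (φ + ψ : Module.Dual ℂ 𝔥) :=
    lie_mem_genWeightSpace_of_mem_genWeightSpace hy hz
  have h1 := ε.ext_of_neg_mem (φ := -φ) (by simpa using hφ)
  have h2 := ε.ext_of_neg_mem (φ := -ψ) (by simpa using hψ)
  have h3 := ε.ext_of_neg_mem (φ := -(φ + ψ)) (by simpa using add_mem hφ hψ)
  apply Subtype.ext
  rw [LieSubalgebra.coe_bracket, coe_toGEps, coe_toGEps, coe_toGEps, LieAlgebra.Prod.bracket_apply,
    SPlus_apply_of_mem ε _ hy, SPlus_apply_of_mem ε _ hz, SPlus_apply_of_mem ε _ hyz,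
    SMinus_apply_of_mem ε _ hy, SMinus_apply_of_mem ε _ hz, SMinus_apply_of_mem ε _ hyz,
    h1, h2, h3, ε.ext_add hφ hψ, smul_lie, lie_smul, smul_lie, lie_smul, smul_smul, smul_smul,
    Complex.ofReal_mul, Complex.ofReal_one, one_mul]

lemma eq_zero_of_mem_rootSpace {φ : Module.Dual ℂ 𝔥} (h0 : φ ≠ 0)
    (h : φ ∉ Set.range (rootSystem 𝔥).root) {z : 𝔤} (hz : z ∈ rootSpace 𝔥 φ) : z = 0 := by
  by_contra hz0
  let γ : Weight ℂ 𝔥 𝔤 := ⟨φ, fun h => hz0 (by simpa [h] using hz)⟩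
  have hγ : γ.toLinear = φ := by ext; simp [γ]
  refine h ⟨⟨γ, ?_⟩, hγ⟩
  simp only [LieSubalgebra.root, Finset.mem_filter, Finset.mem_univ, true_and]
  intro hγ0
  apply h0
  rw [← hγ]
  ext x
  simp [hγ0.eq]

/-- The reflection in `α_r` carries `α_s + (1 - a_rs) α_r` to `α_s - α_r`, which is neither zero nor
a root. This yields the Serre relations in `𝔤`. -/
lemma root_add_nsmul_ne_zero_and_notMem_range {ι M N : Type*} [Finite ι] [AddCommGroup M]
    [Module ℂ M] [AddCommGroup N] [Module ℂ N] {P : RootPairing ι ℂ M N} [P.IsCrystallographic]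
    (b : P.Base) {r s : b.support} (h : r ≠ s) :
    P.root s + (1 - b.cartanMatrix s r).toNat • P.root r ≠ 0 ∧
      P.root s + (1 - b.cartanMatrix s r).toNat • P.root r ∉ Set.range P.root := by
  have hneg := b.cartanMatrix_le_zero_of_ne s r h.symm
  obtain ⟨n, hn⟩ : ∃ n : ℕ, b.cartanMatrix s r = -n := ⟨(-b.cartanMatrix s r).toNat, by omega⟩
  have hc : P.pairing s r = -(n : ℂ) := by
    have h1 : ((b.cartanMatrix s r : ℤ) : ℂ) = P.pairing s r :=
      b.algebraMap_cartanMatrixIn_apply ℤ s r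
    rw [← h1, hn]
    simp
  rw [show (1 - b.cartanMatrix s r).toNat = n + 1 by omega]
  have hrefl : P.reflection r (P.root s + (n + 1) • P.root r) = P.root s - P.root r := by
    rw [_root_.map_add, map_nsmul, P.reflection_apply_self, P.reflection_apply_root, hc]
    module
  constructor
  · intro h0
    rw [h0, _root_.map_zero, eq_comm, sub_eq_zero] at hrefl
    exact h (Subtype.ext (P.root.injective hrefl)).symm
  · rintro ⟨i, hi⟩
    refine b.sub_notMem_range_root s.2 r.2 ⟨P.reflectionPerm r i, ?_⟩
    rw [P.root_reflectionPerm, hi, hrefl]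

/-! ### Relations and generators in the contracted algebra -/

namespace RootVectors

variable {dag : LieInvolution 𝔤} (X : RootVectors b dag) (ε : RealChar b)

lemma lie_Xp_Xm_of_ne {r s : b.support} (h : r ≠ s) :
    ⁅X.Xp (simple b r), X.Xm (simple b s)⁆ = 0 := by
  have h1 : ⁅X.Xp (simple b r), X.Xm (simple b s)⁆ ∈ rootSpace 𝔥
      ((rootSystem 𝔥).root r - (rootSystem 𝔥).root s : Module.Dual ℂ 𝔥) := by
    rw [sub_eq_add_neg]
    exact lie_mem_genWeightSpace_of_mem_genWeightSpace (X.Xp_mem (simple b r))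
      (X.Xm_mem (simple b s))
  refine eq_zero_of_mem_rootSpace ?_ (b.sub_notMem_range_root r.2 s.2) h1
  rw [sub_ne_zero]
  exact fun h2 => h (Subtype.ext ((rootSystem 𝔥).root.injective h2))

lemma serre_Xp {r s : b.support} (h : r ≠ s) :
    ((ad ℂ 𝔤 (X.Xp (simple b r))) ^ (1 - cartan b r s).toNat) (X.Xp (simple b s)) = 0 := by
  have h1 := ad_pow_mem_rootSpace (φ := (rootSystem 𝔥).root r) (ψ := (rootSystem 𝔥).root s)
    (X.Xp_mem (simple b r)) (X.Xp_mem (simple b s)) (1 - cartan b r s).toNat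
  exact eq_zero_of_mem_rootSpace (root_add_nsmul_ne_zero_and_notMem_range b h).1
    (root_add_nsmul_ne_zero_and_notMem_range b h).2 h1

lemma serre_Xm {r s : b.support} (h : r ≠ s) :
    ((ad ℂ 𝔤 (X.Xm (simple b r))) ^ (1 - cartan b r s).toNat) (X.Xm (simple b s)) = 0 := by
  have h1 := congrArg dag (X.serre_Xp h)
  rw [dag.map_zero, dag.map_ad_pow, X.dag_Xp, X.dag_Xp] at h1
  exact (smul_eq_zero.1 h1).resolve_left (by simp)

lemma toGEps_Xp (r : b.support) : (toGEps ε (X.Xp (simple b r)) : 𝔤 × 𝔤) =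
    ((ε.at (simple b r) : ℂ) • X.Xp (simple b r), X.Xp (simple b r)) := by
  rw [coe_toGEps, SPlus_pos ε _ (X.Xp_mem _), SMinus_pos ε _ (X.Xp_mem _)]

lemma toGEps_Xm (r : b.support) : (toGEps ε (X.Xm (simple b r)) : 𝔤 × 𝔤) =
    (X.Xm (simple b r), (ε.at (simple b r) : ℂ) • X.Xm (simple b r)) := by
  rw [coe_toGEps, SPlus_neg ε _ (X.Xm_mem _), SMinus_neg ε _ (X.Xm_mem _)]

lemma toGEps_cartan (h : 𝔥) : (toGEps ε (h : 𝔤) : 𝔤 × 𝔤) = ((h : 𝔤), (h : 𝔤)) := by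
  rw [coe_toGEps, SPlus_cartan ε h.2, SMinus_cartan ε h.2]

lemma star_toGEps (z : 𝔤) : X.star ε (toGEps ε z) = toGEps ε (dag z) :=
  Subtype.ext (Prod.ext (X.dag_SMinus ε z) (X.dag_SPlus ε z))

lemma lie_coroot_Xp (h : 𝔥) (α : PosRoot b) :
    ⁅(h : 𝔤), X.Xp α⁆ = (rootSystem 𝔥).root α.1 h • X.Xp α :=
  lie_eq_smul_of_mem_rootSpace (X.Xp_mem α) h

lemma lie_coroot_Xm (h : 𝔥) (α : PosRoot b) :
    ⁅(h : 𝔤), X.Xm α⁆ = (-(rootSystem 𝔥).root α.1 h) • X.Xm α :=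
  lie_eq_smul_of_mem_rootSpace (X.Xm_mem α) h

lemma exists_hom : ∃ F : GTilde (cartan b) (fun r => ε.at (simple b r)) →ₗ⁅ℂ⁆ gEps ε,
    (∀ r, F (GTilde.Xp _ _ r) = toGEps ε (X.Xp (simple b r))) ∧
    (∀ r, F (GTilde.Xm _ _ r) = toGEps ε (X.Xm (simple b r))) ∧
    ∀ r, F (GTilde.H _ _ r) = toGEps ε ((rootSystem 𝔥).coroot r : 𝔤) := by
  have ad_eq_zero (y z : gEps ε) (n : ℕ)
      (h1 : ((ad ℂ 𝔤 (y : 𝔤 × 𝔤).1) ^ n) (z : 𝔤 × 𝔤).1 = 0)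
      (h2 : ((ad ℂ 𝔤 (y : 𝔤 × 𝔤).2) ^ n) (z : 𝔤 × 𝔤).2 = 0) : ((ad ℂ _ y) ^ n) z = 0 := by
    apply Subtype.ext
    refine Prod.ext ?_ ?_
    · exact (GTilde.map_ad_pow ((LieHom.fst ℂ 𝔤 𝔤).comp (gEps ε).incl) y z n).trans h1
    · exact (GTilde.map_ad_pow ((LieHom.snd ℂ 𝔤 𝔤).comp (gEps ε).incl) y z n).trans h2
  apply GTilde.exists_lift (cartan b) (fun r => ε.at (simple b r))
  · intro r s
    apply Subtype.ext
    rw [LieSubalgebra.coe_bracket, toGEps_cartan, toGEps_cartan, LieAlgebra.Prod.bracket_apply]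
    have h : ⁅(rootSystem 𝔥).coroot r, (rootSystem 𝔥).coroot s⁆ = 0 := trivial_lie_zero 𝔥 𝔥 _ _
    rw [← LieSubalgebra.coe_bracket, h]
    rfl
  · intro r s
    apply Subtype.ext
    rw [LieSubalgebra.coe_bracket, toGEps_cartan, SetLike.val_smul, X.toGEps_Xp,
      LieAlgebra.Prod.bracket_apply, lie_smul, X.lie_coroot_Xp, cartan_spec, Prod.smul_mk,
      smul_comm]
    rfl
  · intro r s
    apply Subtype.ext
    rw [LieSubalgebra.coe_bracket, toGEps_cartan, SetLike.val_smul, X.toGEps_Xm,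
      LieAlgebra.Prod.bracket_apply, lie_smul, X.lie_coroot_Xm, cartan_spec, Prod.smul_mk,
      smul_comm]
    rfl
  · intro r s h
    apply ad_eq_zero <;> simp only [X.toGEps_Xp]
    · rw [ad_smul_pow_smul, X.serre_Xp h, smul_zero]
    · exact X.serre_Xp h
  · intro r s h
    apply ad_eq_zero <;> simp only [X.toGEps_Xm]
    · exact X.serre_Xm h
    · rw [ad_smul_pow_smul, X.serre_Xm h, smul_zero]
  -- Each coordinate rescales exactly one of `X_r⁺`, `X_r⁻`, so the factor `ε_r` appears once in
  -- both.
  · intro r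
    apply Subtype.ext
    rw [LieSubalgebra.coe_bracket, SetLike.val_smul, toGEps_cartan, X.toGEps_Xm, X.toGEps_Xp,
      LieAlgebra.Prod.bracket_apply, smul_lie, lie_smul, X.lie_simple, Prod.smul_mk]
  · intro r s h
    apply Subtype.ext
    rw [LieSubalgebra.coe_bracket, X.toGEps_Xm, X.toGEps_Xp,
      LieAlgebra.Prod.bracket_apply, smul_lie, lie_smul, X.lie_Xp_Xm_of_ne h, smul_zero, smul_zero]
    rfl

/-- Root vectors of weight `φ` are obtained from those of the reflected weight `φ - k α_r`, by
applying `ad X_r⁺` as many times as the weight `k ≥ 0` of `φ` at `r` says. -/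
lemma exists_ad_pow_eq (r : b.support) {φ : Module.Dual ℂ 𝔥} {k : ℕ}
    (hk : φ ((rootSystem 𝔥).coroot r) = k) {z : 𝔤} (hz : z ∈ rootSpace 𝔥 φ) :
    ∃ u ∈ rootSpace 𝔥 (φ - k • (rootSystem 𝔥).root r : Module.Dual ℂ 𝔥),
      ((ad ℂ 𝔤 (X.Xp (simple b r))) ^ k) u = z := by
  set α : Module.Dual ℂ 𝔥 := (rootSystem 𝔥).root r with hα
  have hp : X.Xp (simple b r) ∈ rootSpace 𝔥 α := X.Xp_mem (simple b r)
  have hm : X.Xm (simple b r) ∈ rootSpace 𝔥 (-α : Module.Dual ℂ 𝔥) := X.Xm_mem (simple b r)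
  have hα2 : α ((rootSystem 𝔥).coroot r) = 2 := (rootSystem 𝔥).root_coroot_two r
  have hα0 : (α : 𝔥 → ℂ) ≠ 0 := fun h => by simp [h] at hα2
  have hsl : GradedSl2 (ad ℂ 𝔤 (X.Xp (simple b r))) (ad ℂ 𝔤 (X.Xm (simple b r)))
      (fun i => (rootSpace 𝔥 (φ + i • α : Module.Dual ℂ 𝔥)).toSubmodule) k :=
    { e_mem := fun i w hw => by
        rw [show φ + (i + 1) • α = α + (φ + i • α) by module]
        exact lie_mem_genWeightSpace_of_mem_genWeightSpace hp hw
      f_mem := fun i w hw => by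
        rw [show φ + (i - 1) • α = -α + (φ + i • α) by module]
        exact lie_mem_genWeightSpace_of_mem_genWeightSpace hm hw
      lie_e_f := fun i w hw => by
        have h1 := lie_eq_smul_of_mem_rootSpace (α := ⇑(φ + i • α)) hw ((rootSystem 𝔥).coroot r)
        rw [ad_apply, ad_apply, ad_apply, ad_apply, ← lie_lie, X.lie_simple]
        refine h1.trans ?_
        rw [LinearMap.add_apply, LinearMap.smul_apply, hk, hα2]
        congr 1
        push_cast
        rw [zsmul_eq_mul]
        ring }
  obtain ⟨u, hu, huz⟩ := hsl.exists_e_pow_eq (isNilpotent_ad_of_mem_rootSpace 𝔥 hα0 hp)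
    (w := z) (by simpa using hz)
  refine ⟨u, ?_, huz⟩
  have h2 : φ - k • α = φ + (-k : ℤ) • α := by module
  rw [h2]
  exact hu

lemma toGEps_ad_pow_mem (R : LieSubalgebra ℂ (gEps ε))
    (hR : ∀ r, toGEps ε (X.Xp (simple b r)) ∈ R) (r : b.support) {φ : Module.Dual ℂ 𝔥}
    (hφ : φ ∈ QPlus b) {u : 𝔤} (hu : u ∈ rootSpace 𝔥 φ) (huR : toGEps ε u ∈ R) (m : ℕ) :
    toGEps ε (((ad ℂ 𝔤 (X.Xp (simple b r))) ^ m) u) ∈ R := by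
  have hp : X.Xp (simple b r) ∈ rootSpace 𝔥 ((rootSystem 𝔥).root r) := X.Xp_mem (simple b r)
  induction m with
  | zero => exact huR
  | succ m ih =>
    rw [pow_succ', Module.End.mul_apply, ad_apply, ← lie_toGEps ε (simple_mem b r)
      (add_mem hφ (nsmul_mem (simple_mem b r) m)) hp (ad_pow_mem_rootSpace hp hu m)]
    exact R.lie_mem (hR r) ih

/-- Induction on the height. A positive root `i` pairs positively with some simple `j`; if `i ≠ j`,
reflecting in `j` gives a lower positive root, and `ad(X_j⁺)^k` climbs back. Membership in `QPlus`
is carried along, because the climb stays inside `R` only where the parametrization respects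
brackets. -/
lemma toGEps_mem_of_isPos (R : LieSubalgebra ℂ (gEps ε))
    (hR : ∀ r, toGEps ε (X.Xp (simple b r)) ∈ R) {i : 𝔥.root} (hi : b.IsPos i) :
    (rootSystem 𝔥).root i ∈ QPlus b ∧
      ∀ z ∈ rootSpace 𝔥 ((rootSystem 𝔥).root i), toGEps ε z ∈ R := by
  generalize hn : (b.height i).toNat = n
  induction n using Nat.strong_induction_on generalizing i with
  | _ n ih =>
  obtain ⟨j, hj, hj'⟩ := hi.exists_mem_support_pos_pairingIn
  rw [(rootSystem 𝔥).zero_lt_pairingIn_iff'] at hj'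
  rcases eq_or_ne i j with rfl | hij
  · refine ⟨simple_mem b ⟨i, hj⟩, fun z hz => ?_⟩
    let α : PosRoot b := simple b ⟨i, hj⟩
    obtain ⟨c, hc⟩ := (finrank_eq_one_iff_of_nonzero' (⟨X.Xp α, X.Xp_mem α⟩ : rootSpace 𝔥 i.1)
      (fun h => X.Xp_ne_zero α (congrArg Subtype.val h))).1
      (finrank_rootSpace_eq_one i.1 (Finset.mem_filter.1 i.2).2) ⟨z, hz⟩
    have hc' : c • X.Xp α = z := congrArg Subtype.val hc
    rw [← hc', _root_.map_smul]
    exact R.smul_mem c (hR _)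
  obtain ⟨k, hk⟩ := Int.eq_ofNat_of_zero_le hj'.le
  have hpair : (rootSystem 𝔥).root i ((rootSystem 𝔥).coroot j) = k := by
    have h1 : (((rootSystem 𝔥).pairingIn ℤ i j : ℤ) : ℂ) = (rootSystem 𝔥).pairing i j :=
      (rootSystem 𝔥).algebraMap_pairingIn ℤ i j
    rw [hk] at h1
    exact_mod_cast h1.symm
  have hroot : (rootSystem 𝔥).root ((rootSystem 𝔥).reflectionPerm j i) =
      (rootSystem 𝔥).root i + (-k : ℤ) • (rootSystem 𝔥).root j := by
    rw [(rootSystem 𝔥).root_reflectionPerm, (rootSystem 𝔥).reflection_apply_root' ℤ, hk, neg_smul,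
      ← sub_eq_add_neg]
  have hpos := hi.reflectionPerm hj hij
  have hheight := b.height_add_zsmul hroot
  rw [b.height_one_of_mem_support hj] at hheight
  have hi' : 0 < b.height i := (b.isPos_iff).1 hi
  obtain ⟨hQ, hmem⟩ := ih _ (by simp at hheight; omega) hpos rfl
  have hjQ := simple_mem b ⟨j, hj⟩
  have hroot' : (rootSystem 𝔥).root i = (rootSystem 𝔥).root ((rootSystem 𝔥).reflectionPerm j i) +
      k • (rootSystem 𝔥).root j := by
    rw [hroot]
    module
  refine ⟨hroot' ▸ add_mem hQ (nsmul_mem hjQ k), fun z hz => ?_⟩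
  obtain ⟨u, hu, rfl⟩ := X.exists_ad_pow_eq ⟨j, hj⟩ hpair hz
  have hsub : (rootSystem 𝔥).root i - k • (rootSystem 𝔥).root j =
      (rootSystem 𝔥).root ((rootSystem 𝔥).reflectionPerm j i) := by
    rw [hroot', add_sub_cancel_right]
  rw [hsub] at hu
  exact X.toGEps_ad_pow_mem ε R hR ⟨j, hj⟩ hQ hu (hmem u hu) k

lemma dag_mem_rootSpace_neg (X : RootVectors b dag) (i : 𝔥.root) {z : 𝔤} (hz : z ∈ rootSpace 𝔥 i.1) :
    dag z ∈ rootSpace 𝔥 ((rootSystem 𝔥).root ((rootSystem 𝔥).reflectionPerm i i)) := by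
  have h : (rootSystem 𝔥).root ((rootSystem 𝔥).reflectionPerm i i) =
      -(rootSystem 𝔥).root i := by
    rw [(rootSystem 𝔥).root_reflectionPerm, (rootSystem 𝔥).reflection_apply_self]
  rw [h]
  exact X.dag_mem i.1 hz

/-- `𝔤_ε` is generated by the elements which correspond to `X_r⁺`, `X_r⁻` and `h_r`. -/
lemma lieSubalgebra_eq_top (R : LieSubalgebra ℂ (gEps ε))
    (hstar : ∀ y ∈ R, X.star ε y ∈ R)
    (hR : ∀ r, toGEps ε (X.Xp (simple b r)) ∈ R)
    (hR' : ∀ r : b.support, toGEps ε ((rootSystem 𝔥).coroot r : 𝔤) ∈ R) : R = ⊤ := by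
  rw [eq_top_iff]
  intro y _
  obtain ⟨z, rfl⟩ := toGEps_surjective ε y
  induction z using weight_induction 𝔥 with
  | zero => rw [_root_.map_zero]; exact R.zero_mem
  | add y z hy hz => rw [_root_.map_add]; exact R.add_mem (hy trivial) (hz trivial)
  | mem χ z hz =>
    by_cases hχ : χ.IsZero
    · have h1 : (χ : 𝔥 → ℂ) = 0 := hχ.eq
      rw [h1, rootSpace_zero_eq] at hz
      obtain ⟨h, rfl⟩ : ∃ h : 𝔥, (h : 𝔤) = z := ⟨⟨z, by simpa using hz⟩, rfl⟩
      have h2 : h ∈ Submodule.span ℂ (Set.range b.toCoweightBasis) := by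
        rw [b.toCoweightBasis.span_eq]; trivial
      have h3 : Submodule.span ℂ (Set.range b.toCoweightBasis) ≤
          R.toSubmodule.comap ((toGEps ε).comp 𝔥.toSubmodule.subtype) := by
        rw [Submodule.span_le]
        rintro _ ⟨r, rfl⟩
        rw [b.toCoweightBasis_apply]
        exact hR' r
      exact h3 h2
    · let i : 𝔥.root := ⟨χ, by simpa using hχ⟩
      rcases RootPairing.Base.IsPos.or_neg b i with hi | hi
      · exact (X.toGEps_mem_of_isPos ε R hR hi).2 z hz
      · have h1 := (X.toGEps_mem_of_isPos ε R hR hi).2 (dag z) (X.dag_mem_rootSpace_neg i hz)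
        have h2 := hstar _ h1
        rwa [X.star_toGEps, dag.apply_apply] at h2

end RootVectors

end Contraction

/-- Both sides are antilinear and reverse brackets, so generators suffice. The case of `X_r⁻`
follows from that of `X_r⁺` by involutivity. -/
lemma eqOn_star_of_generators {I L : Type*} [LieRing L] [LieAlgebra ℂ L] {a : Matrix I I ℤ}
    {ε : I → ℝ} (F : GTilde a ε →ₗ⁅ℂ⁆ L) (d : LieInvolution L)
    (hp : ∀ r, d (F (GTilde.Xp a ε r)) = F (GTilde.Xm a ε r))
    (hH : ∀ r, d (F (GTilde.H a ε r)) = F (GTilde.H a ε r)) (x : GTilde a ε) :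
    F (GTilde.star a ε x) = d (F x) := by
  have hx : x ∈ LieSubalgebra.lieSpan ℂ (GTilde a ε) _ :=
    GTilde.lieSpan_eq_top a ε ▸ LieSubalgebra.mem_top x
  induction hx using LieSubalgebra.lieSpan_induction with
  | mem x hx =>
    rcases hx with ⟨r, rfl⟩ | ⟨r, rfl⟩ | ⟨r, rfl⟩
    · rw [GTilde.star_H, hH]
    · rw [GTilde.star_Xp, hp]
    · rw [GTilde.star_Xm, ← hp, d.apply_apply]
  | zero => rw [LieInvolution.map_zero, _root_.map_zero, d.map_zero]
  | add x y _ _ hx hy =>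
    rw [LieInvolution.map_add, _root_.map_add, _root_.map_add, d.map_add, hx, hy]
  | smul c x _ hx =>
    rw [LieInvolution.map_smul, _root_.map_smul, _root_.map_smul, d.map_smul, hx]
  | lie x y _ _ hx hy =>
    rw [LieInvolution.map_lie, LieHom.map_lie, LieHom.map_lie, d.map_lie, hx, hy]

end

end EpsLie

theorem mainTheorem12 {𝔤 : Type*} [LieRing 𝔤] [LieAlgebra ℂ 𝔤] [FiniteDimensional ℂ 𝔤]
    [LieAlgebra.IsSimple ℂ 𝔤]
    (𝔥 : LieSubalgebra ℂ 𝔤) [𝔥.IsCartanSubalgebra]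
    (b : (LieAlgebra.IsKilling.rootSystem 𝔥).Base)
    (dag : EpsLie.LieInvolution 𝔤) (hdag : dag.IsCompact)
    (X : EpsLie.RootVectors b dag) (ε : EpsLie.RealChar b) :
    ∃ Φ : EpsLie.GTilde (EpsLie.cartan b) (fun r => ε.at (EpsLie.simple b r)) ≃ₗ⁅ℂ⁆
        EpsLie.gEps ε,
      ∀ x, Φ (EpsLie.GTilde.star (EpsLie.cartan b) (fun r => ε.at (EpsLie.simple b r)) x) =
        X.star ε (Φ x) := by
  obtain ⟨F, hp, hm, hH⟩ := X.exists_hom ε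
  have hstar := EpsLie.eqOn_star_of_generators F (X.star ε)
    (fun r => by rw [hp, hm, X.star_toGEps, X.dag_Xp])
    (fun r => by rw [hH, X.star_toGEps, X.dag_coroot])
  -- The range is closed under the involution because `F` intertwines the two involutions, so
  -- positive root vectors and coroots suffice.
  have htop : F.range = ⊤ := X.lieSubalgebra_eq_top ε F.range
    (by rintro _ ⟨x, rfl⟩; exact ⟨_, hstar x⟩) (fun r => ⟨_, hp r⟩) (fun r => ⟨_, hH r⟩)
  have hsurj : Function.Surjective F := fun y => by
    have : y ∈ F.range := htop ▸ LieSubalgebra.mem_top y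
    exact this
  obtain ⟨hfin, hle⟩ := EpsLie.GTilde.finite_and_finrank_le b fun r => ε.at (EpsLie.simple b r)
  change Module.Finite ℂ (EpsLie.GTilde (EpsLie.cartan b) _) at hfin
  replace hle : Module.finrank ℂ (EpsLie.GTilde (EpsLie.cartan b)
      fun r => ε.at (EpsLie.simple b r)) ≤ Module.finrank ℂ 𝔤 :=
    hle.trans (EpsLie.card_add_card_le_finrank b)
  have heq : Module.finrank ℂ 𝔤 = Module.finrank ℂ (EpsLie.gEps ε) :=
    (LinearEquiv.ofBijective (EpsLie.toGEps ε)
      ⟨EpsLie.toGEps_injective ε, EpsLie.toGEps_surjective ε⟩).finrank_eq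
  have hinj : Function.Injective F :=
    (LinearMap.injective_iff_surjective_of_finrank_eq_finrank (f := F.toLinearMap)
      (le_antisymm (hle.trans heq.le)
        (LinearMap.finrank_le_finrank_of_surjective (f := F.toLinearMap) hsurj))).2 hsurj
  exact ⟨LieEquiv.ofBijective F ⟨hinj, hsurj⟩, hstar⟩
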